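/- Let $\mathbf{k}$ be a field. For $m,n\ge 0$ let ${}_mB^-_n$ be the set of isotopy classes of planar diagrams in the strip $0\le x\le 1$ with $m$ marked points on the line $x=0$ and $n$ marked points on the line $x=1$, in which some $k\le\min(m,n)$ of the left points are joined to $k$ of the right points by disjoint arcs (larcs), each remaining marked point is the end of a short arc (sarc) whose other end lies in the interior of the strip, and the projection to the $x$-axis has no critical points. (Such a class is the same as an order-preserving bijection between a subset of the $m$ left points and a subset of the $n$ right points.) Let $A^-$ be the $\mathbf{k}$-algebra with basis $B^-=\bigsqcup_{m,n\ge0}{}_mB^-_n$, the product of $y\in{}_mB^-_n$ and $z\in{}_{n'}B^-_{l}$ being their concatenation if $n=n'$ and the concatenation has no arc disjoint from both boundary lines, and $0$ otherwise. Let $1_n\in{}_nB^-_n$ be the diagram without sarcs, and let $A^-_d$ be the span of the diagrams with exactly $d$ sarcs in total. Modules are left $A^-$-modules $M$ with $M=\bigoplus_{n\ge0}1_nM$. Let $L_n=\mathbf{k}1_n$ be the one-dimensional module on which $1_n$ acts as the identity and every other diagram acts by zero. A linear graded projective resolution of a module $S$, placed in degree $0$, is an exact sequence $\cdots\to P^2\to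 P^1\to P^0\to S\to0$ of graded modules and degree-preserving homomorphisms in which every $P^i$ is projective and generated by its component of degree $i$. Then $A^-$ with the grading by the total number of sarcs is a Koszul algebra. That is: the $1_n$ are non-zero orthogonal idempotents and $A^-=\bigoplus_{m,n}1_mA^-1_n$; $A^-=\bigoplus_{d\ge0}A^-_d$ with $A^-_iA^-_j\subseteq A^-_{i+j}$; $A^-_0=\bigoplus_n\mathbf{k}1_n$; and every simple module annihilated by $\bigoplus_{d>0}A^-_d$ has a linear graded projective resolution. Moreover, every module $L_n$, $n\ge0$, and indeed every simple $A^-$-module, has a linear graded projective resolution. -/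

import Mathlib

universe u v w

/-! ### Planar diagrams of long and short arcs -/

/-- An isotopy class of slarc diagrams with `left` points on the line `x = 0` and `right` points on
the line `x = 1`, both numbered from bottom to top starting with `0`. The pair `(i, j)` belongs to
`larcs` when a long arc joins the left point `i` to the right point `j`. Long arcs are disjoint and
have no critical points, so their endpoints come in the same order on both lines (and no two of
them share an endpoint); the remaining points carry short arcs, and the isotopy class is determined
by these data. -/
@[ext]
structure SlarcDiagram where
  left : ℕ
  right : ℕ
  larcs : Finset (ℕ × ℕ)
  left_lt : ∀ p ∈ larcs, p.1 < left
  right_lt : ∀ p ∈ larcs, p.2 < right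
  planar : ∀ p ∈ larcs, ∀ q ∈ larcs, p.1 < q.1 ↔ p.2 < q.2

namespace SlarcDiagram

/-- The left points that are ends of short arcs. -/
def leftSarcs (x : SlarcDiagram) : Finset ℕ :=
  (Finset.range x.left).filter fun i => ∀ p ∈ x.larcs, p.1 ≠ i

/-- The right points that are ends of short arcs. -/
def rightSarcs (x : SlarcDiagram) : Finset ℕ :=
  (Finset.range x.right).filter fun j => ∀ p ∈ x.larcs, p.2 ≠ j

/-- The total number of short arcs of a diagram. -/
def numSarcs (x : SlarcDiagram) : ℕ := x.leftSarcs.card + x.rightSarcs.card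

/-- The diagram `1_n`: `n` parallel long arcs, no short arcs. -/
def one (n : ℕ) : SlarcDiagram where
  left := n
  right := n
  larcs := (Finset.range n).image fun i => (i, i)
  left_lt := by simp
  right_lt := by simp
  planar := by simp

/-- The concatenation of `x` (on the left) with `y` (on the right), with any floating arcs removed;
only used for diagrams with `x.right = y.left`. -/
def concat (x y : SlarcDiagram) : SlarcDiagram where
  left := x.left
  right := y.right
  larcs := (Finset.range x.left ×ˢ Finset.range y.right).filter fun p =>
    ∃ q ∈ x.larcs, ∃ r ∈ y.larcs, q.1 = p.1 ∧ q.2 = r.1 ∧ r.2 = p.2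
  left_lt := by
    intro p hp
    simp only [Finset.mem_filter, Finset.mem_product, Finset.mem_range] at hp
    exact hp.1.1
  right_lt := by
    intro p hp
    simp only [Finset.mem_filter, Finset.mem_product, Finset.mem_range] at hp
    exact hp.1.2
  planar := by
    intro p hp p' hp'
    simp only [Finset.mem_filter] at hp hp'
    obtain ⟨-, q, hq, r, hr, h1, h2, h3⟩ := hp
    obtain ⟨-, q', hq', r', hr', h1', h2', h3'⟩ := hp'
    have hx := x.planar q hq q' hq'
    have hy := y.planar r hr r' hr'
    rw [← h1, ← h1', ← h3, ← h3', hx, ← hy, h2, h2']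

/-- The concatenation of `x` and `y` is defined (the numbers of points on the common line agree)
and has no floating arc: no point of the common line ends a short arc on both sides. -/
def Composable (x y : SlarcDiagram) : Prop :=
  x.right = y.left ∧ Disjoint x.rightSarcs y.leftSarcs

lemma mem_concat {x y : SlarcDiagram} {i j : ℕ} :
    (i, j) ∈ (concat x y).larcs ↔ ∃ l, (i, l) ∈ x.larcs ∧ (l, j) ∈ y.larcs := by
  simp only [concat, Finset.mem_filter, Finset.mem_product, Finset.mem_range]
  constructor
  · rintro ⟨-, ⟨a, b⟩, hq, ⟨c, d⟩, hr, h1, h2, h3⟩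
    simp only at h1 h2 h3
    subst h1 h2 h3
    exact ⟨b, hq, hr⟩
  · rintro ⟨l, h1, h2⟩
    exact ⟨⟨x.left_lt _ h1, y.right_lt _ h2⟩, _, h1, _, h2, rfl, rfl, rfl⟩

lemma larc_eq_left (x : SlarcDiagram) {i j j' : ℕ} (h : (i, j) ∈ x.larcs)
    (h' : (i, j') ∈ x.larcs) : j = j' := by
  have h1 := x.planar _ h _ h'
  have h2 := x.planar _ h' _ h
  simp only [lt_self_iff_false, false_iff] at h1 h2
  omega

lemma larc_eq_right (x : SlarcDiagram) {i i' j : ℕ} (h : (i, j) ∈ x.larcs)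
    (h' : (i', j) ∈ x.larcs) : i = i' := by
  have h1 := x.planar _ h _ h'
  have h2 := x.planar _ h' _ h
  simp only [lt_self_iff_false, iff_false] at h1 h2
  omega

lemma composable_iff {x y : SlarcDiagram} : Composable x y ↔ x.right = y.left ∧
    ∀ l < y.left, (∃ i, (i, l) ∈ x.larcs) ∨ ∃ j, (l, j) ∈ y.larcs := by
  unfold Composable
  refine and_congr_right fun h => ?_
  rw [Finset.disjoint_left]
  simp only [rightSarcs, leftSarcs, Finset.mem_filter, Finset.mem_range, Prod.forall, h]
  constructor
  · intro H l hl
    by_contra hc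
    push Not at hc
    exact H ⟨hl, fun a b hab e => hc.1 a (e ▸ hab)⟩ ⟨hl, fun a b hab e => hc.2 b (e ▸ hab)⟩
  · rintro H l ⟨hl, h1⟩ ⟨-, h2⟩
    rcases H l hl with ⟨i, hi⟩ | ⟨j, hj⟩
    · exact h1 _ _ hi rfl
    · exact h2 _ _ hj rfl

lemma concat_assoc (x y z : SlarcDiagram) :
    concat (concat x y) z = concat x (concat y z) := by
  ext1
  · rfl
  · rfl
  · ext ⟨i, j⟩
    simp only [mem_concat]
    grind

lemma composable_assoc (x y z : SlarcDiagram) :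
    (Composable x y ∧ Composable (concat x y) z) ↔
      (Composable y z ∧ Composable x (concat y z)) := by
  have e1 : (concat x y).right = y.right := rfl
  have e2 : (concat y z).left = y.left := rfl
  simp only [composable_iff, mem_concat, e1, e2]
  constructor
  · rintro ⟨⟨h1, h2⟩, h3, h4⟩
    refine ⟨⟨h3, fun l hl => ?_⟩, h1, fun l hl => ?_⟩
    · rcases h4 l hl with ⟨i, m, -, hm⟩ | h
      · exact Or.inl ⟨m, hm⟩
      · exact Or.inr h
    · rcases h2 l hl with h | ⟨j, hj⟩
      · exact Or.inl h
      · rcases h4 j (h3 ▸ y.right_lt _ hj) with ⟨i, m, hi, hm⟩ | ⟨p, hp⟩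
        · rw [y.larc_eq_right hm hj] at hi
          exact Or.inl ⟨i, hi⟩
        · exact Or.inr ⟨p, j, hj, hp⟩
  · rintro ⟨⟨h3, h4⟩, h1, h2⟩
    refine ⟨⟨h1, fun l hl => ?_⟩, h3, fun l hl => ?_⟩
    · rcases h2 l hl with h | ⟨j, m, hm, -⟩
      · exact Or.inl h
      · exact Or.inr ⟨m, hm⟩
    · rcases h4 l hl with ⟨j, hj⟩ | h
      · rcases h2 j (y.left_lt _ hj) with ⟨i, hi⟩ | ⟨p, m, hm, hp⟩
        · exact Or.inl ⟨i, j, hi, hj⟩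
        · rw [y.larc_eq_left hm hj] at hp
          exact Or.inr ⟨p, hp⟩
      · exact Or.inr h

lemma mem_one {n i j : ℕ} : (i, j) ∈ (one n).larcs ↔ i = j ∧ i < n := by
  simp only [one, Finset.mem_image, Finset.mem_range, Prod.mk.injEq]
  constructor
  · rintro ⟨a, h, rfl, rfl⟩
    exact ⟨rfl, h⟩
  · rintro ⟨rfl, h⟩
    exact ⟨i, h, rfl, rfl⟩

/-- The identity diagram is only the product of two identity diagrams. -/
lemma eq_one_iff (n : ℕ) (x y : SlarcDiagram) :
    (Composable x y ∧ concat x y = one n) ↔ (x = one n ∧ y = one n) := by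
  constructor
  · rintro ⟨hc, h⟩
    rw [composable_iff] at hc
    obtain ⟨hm, hc⟩ := hc
    have hl : x.left = n := congrArg left h
    have hr : y.right = n := congrArg right h
    have key : ∀ i < n, ∃ l, (i, l) ∈ x.larcs ∧ (l, i) ∈ y.larcs := fun i hi =>
      mem_concat.1 (h ▸ mem_one.2 ⟨rfl, hi⟩)
    choose! f hf1 hf2 using key
    have fsurj : ∀ l < y.left, ∃ i < n, f i = l := by
      intro l hl'
      rcases hc l hl' with ⟨i, hi⟩ | ⟨j, hj⟩
      · have hin : i < n := hl ▸ x.left_lt _ hi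
        exact ⟨i, hin, x.larc_eq_left (hf1 i hin) hi⟩
      · have hjn : j < n := hr ▸ y.right_lt _ hj
        exact ⟨j, hjn, y.larc_eq_right (hf2 j hjn) hj⟩
    have fmono : ∀ i < n, ∀ j < n, i < j → f i < f j := fun i hi j hj hij =>
      (x.planar _ (hf1 i hi) _ (hf1 j hj)).1 hij
    have flt : ∀ i < n, f i < y.left := fun i hi => y.left_lt _ (hf2 i hi)
    have fid : ∀ i < n, f i = i := by
      intro i
      induction i using Nat.strong_induction_on with
      | _ i ih =>
        intro hi
        have hge : i ≤ f i := by
          by_contra hlt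
          push Not at hlt
          have h1 := ih (f i) hlt (hlt.trans hi)
          have h2 := fmono _ (hlt.trans hi) _ hi hlt
          omega
        by_contra hne
        obtain ⟨j, hj, hji⟩ := fsurj i (lt_of_le_of_lt hge (flt i hi))
        rcases lt_trichotomy i j with h1 | h1 | h1
        · have := fmono _ hi _ hj h1
          omega
        · subst h1; exact hne hji
        · have := ih j h1 hj
          omega
    have hmid : y.left = n := by
      apply le_antisymm
      · by_contra hlt
        push Not at hlt
        obtain ⟨i, hi, hin⟩ := fsurj n hlt
        rw [fid i hi] at hin
        omega
      · by_contra hlt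
        push Not at hlt
        have := flt _ hlt
        rw [fid _ hlt] at this
        omega
    constructor
    · ext1
      · exact hl
      · exact hm.trans hmid
      · ext ⟨i, j⟩
        rw [mem_one]
        constructor
        · intro hij
          have hi : i < n := hl ▸ x.left_lt _ hij
          exact ⟨by rw [← fid i hi]; exact x.larc_eq_left (hf1 i hi) hij, hi⟩
        · rintro ⟨rfl, hi⟩
          have := hf1 i hi
          rwa [fid i hi] at this
    · ext1
      · exact hmid
      · exact hr
      · ext ⟨i, j⟩
        rw [mem_one]
        constructor
        · intro hij
          have hj : j < n := hr ▸ y.right_lt _ hij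
          have e : i = j := by
            rw [← fid j hj]; exact y.larc_eq_right hij (hf2 j hj)
          exact ⟨e, e ▸ hj⟩
        · rintro ⟨rfl, hi⟩
          have := hf2 i hi
          rwa [fid i hi] at this
  · rintro ⟨rfl, rfl⟩
    constructor
    · rw [composable_iff]
      exact ⟨rfl, fun l hl => Or.inl ⟨l, mem_one.2 ⟨rfl, hl⟩⟩⟩
    · ext1
      · rfl
      · rfl
      · ext ⟨i, j⟩
        simp only [mem_concat, mem_one]
        grind

end SlarcDiagram

/-! ### The algebra of slarcs -/

/-- The vector space over `k` with basis the set of all slarc diagrams. -/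
def SlarcAlgebra (k : Type u) [Field k] : Type u := SlarcDiagram →₀ k

namespace SlarcAlgebra

noncomputable section

variable (k : Type u) [Field k]

instance : AddCommGroup (SlarcAlgebra k) := inferInstanceAs (AddCommGroup (SlarcDiagram →₀ k))

instance : Module k (SlarcAlgebra k) := inferInstanceAs (Module k (SlarcDiagram →₀ k))

/-- The basis of the algebra formed by the diagrams. -/
def basis : Module.Basis SlarcDiagram k (SlarcAlgebra k) :=
  Module.Basis.ofRepr (LinearEquiv.refl k (SlarcDiagram →₀ k))

/-- The basis vector of the algebra given by a diagram. -/
def diag (x : SlarcDiagram) : SlarcAlgebra k := basis k x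

open Classical in
/-- The product of two diagrams: their concatenation, or zero if the concatenation is not defined
or contains a floating arc. -/
def diagMul (x y : SlarcDiagram) : SlarcAlgebra k :=
  if x.Composable y then diag k (x.concat y) else 0

/-- The bilinear extension of the product of diagrams. -/
def mulBilin : SlarcAlgebra k →ₗ[k] SlarcAlgebra k →ₗ[k] SlarcAlgebra k :=
  (basis k).constr k fun x => (basis k).constr k fun y => diagMul k x y

instance : Mul (SlarcAlgebra k) := ⟨fun a b => mulBilin k a b⟩

lemma mul_def (a b : SlarcAlgebra k) : a * b = mulBilin k a b := rfl

lemma diag_mul_diag (x y : SlarcDiagram) : diag k x * diag k y = diagMul k x y := by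
  rw [mul_def, mulBilin, diag, diag, Module.Basis.constr_basis, Module.Basis.constr_basis]

lemma span_diag : Submodule.span k (Set.range (diag k)) = ⊤ := (basis k).span_eq

lemma diag_assoc (x y z : SlarcDiagram) :
    diag k x * diag k y * diag k z = diag k x * (diag k y * diag k z) := by
  classical
  have h := SlarcDiagram.composable_assoc x y z
  have z1 : ∀ a : SlarcAlgebra k, (0 : SlarcAlgebra k) * a = 0 := fun a => by
    rw [mul_def, map_zero, LinearMap.zero_apply]
  have z2 : ∀ a : SlarcAlgebra k, a * (0 : SlarcAlgebra k) = 0 := fun a => by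
    rw [mul_def, map_zero]
  rw [diag_mul_diag, diag_mul_diag]
  by_cases h1 : x.Composable y <;> by_cases h2 : y.Composable z <;>
    simp only [diagMul, h1, h2, if_true, if_false, z1, z2, diag_mul_diag] at h ⊢
  · simp only [true_and] at h
    simp only [h, SlarcDiagram.concat_assoc]
  · simp only [true_and, false_and, iff_false] at h
    simp only [h, if_false]
  · simp only [true_and, false_and, false_iff] at h
    simp only [h, if_false]

lemma diag_induction {p : SlarcAlgebra k → Prop} (hd : ∀ x, p (diag k x)) (h0 : p 0)
    (ha : ∀ a b, p a → p b → p (a + b)) (hs : ∀ (c : k) a, p a → p (c • a))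
    (a : SlarcAlgebra k) : p a := by
  have h : a ∈ Submodule.span k (Set.range (diag k)) := by rw [span_diag]; trivial
  induction h using Submodule.span_induction with
  | mem x hx => obtain ⟨y, rfl⟩ := hx; exact hd y
  | zero => exact h0
  | add x y _ _ hx hy => exact ha x y hx hy
  | smul c x _ hx => exact hs c x hx

instance : NonUnitalNonAssocRing (SlarcAlgebra k) where
  left_distrib a b c := map_add (mulBilin k a) b c
  right_distrib a b c := by simp only [mul_def, map_add, LinearMap.add_apply]
  zero_mul a := by rw [mul_def, map_zero, LinearMap.zero_apply]
  mul_zero a := by rw [mul_def, map_zero]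

instance : IsScalarTower k (SlarcAlgebra k) (SlarcAlgebra k) where
  smul_assoc c a b := by
    simp only [smul_eq_mul, mul_def, map_smul, LinearMap.smul_apply]

instance : SMulCommClass k (SlarcAlgebra k) (SlarcAlgebra k) where
  smul_comm c a b := by
    simp only [smul_eq_mul, mul_def, map_smul]

instance : NonUnitalRing (SlarcAlgebra k) where
  mul_assoc a b c := by
    induction a using diag_induction with
    | hd x =>
      induction b using diag_induction with
      | hd y =>
        induction c using diag_induction with
        | hd z => exact diag_assoc k x y z
        | h0 => simp only [mul_zero]
        | ha a b h1 h2 => simp only [mul_add, h1, h2]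
        | hs c a h => simp only [mul_smul_comm, h]
      | h0 => simp only [mul_zero, zero_mul]
      | ha a b h1 h2 => simp only [mul_add, add_mul, h1, h2]
      | hs c a h => simp only [mul_smul_comm, smul_mul_assoc, h]
    | h0 => simp only [zero_mul]
    | ha a b h1 h2 => simp only [add_mul, h1, h2]
    | hs c a h => simp only [smul_mul_assoc, h]

/-- The idempotents `1_n`. -/
def idem (n : ℕ) : SlarcAlgebra k := diag k (SlarcDiagram.one n)

/-- The homogeneous component of degree `d`: the span of the diagrams with `d` short arcs. -/
def sarcGrading (d : ℕ) : Submodule k (SlarcAlgebra k) :=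
  Submodule.span k (diag k '' {x | x.numSarcs = d})

/-- The coefficient of the diagram `1_n`, a multiplicative functional. -/
def coeffOne (n : ℕ) : SlarcAlgebra k →ₙₐ[k] k :=
  let φ : SlarcAlgebra k →ₗ[k] k := (basis k).coord (SlarcDiagram.one n)
  { φ with
    map_zero' := map_zero φ
    map_mul' := by
      classical
      have hφ : ∀ x, φ (diag k x) = if x = SlarcDiagram.one n then 1 else 0 := fun x => by
        rw [diag, Module.Basis.coord_apply, Module.Basis.repr_self, Finsupp.single_apply]
      intro a b
      change φ (a * b) = φ a * φ b
      induction a using diag_induction with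
      | hd x =>
        induction b using diag_induction with
        | hd y =>
          have h := SlarcDiagram.eq_one_iff n x y
          rw [diag_mul_diag, diagMul, hφ, hφ]
          by_cases hc : x.Composable y
          · rw [if_pos hc, hφ]
            simp only [hc, true_and] at h
            simp only [h, ite_and, mul_ite, mul_one, mul_zero]
            split_ifs <;> rfl
          · rw [if_neg hc, map_zero]
            simp only [hc, false_and, false_iff, not_and] at h
            split_ifs with h1 h2
            · exact absurd h2 (h h1)
            all_goals simp
        | h0 => simp only [mul_zero, map_zero]
        | ha a b h1 h2 => simp only [mul_add, map_add, h1, h2]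
        | hs c a h => rw [mul_smul_comm, map_smul, map_smul, h, mul_smul_comm]
      | h0 => simp only [zero_mul, map_zero]
      | ha a b h1 h2 => simp only [add_mul, map_add, h1, h2]
      | hs c a h => rw [smul_mul_assoc, map_smul, map_smul, h, smul_mul_assoc] }

end

end SlarcAlgebra

/-! ### Modules over locally unital graded algebras

A left module over an algebra `A` without unit is the same as a unital left module over the algebra
`Unitization k A = k ⊕ A`; the element `a` of `A` acts as `(a : Unitization k A)`. -/

/-- The module is the direct sum of its subspaces `e i • M`. -/
def IsLocallyUnital {k A : Type u} [Field k] [NonUnitalRing A] [Module k A] [IsScalarTower k A A]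
    [SMulCommClass k A A] {ι : Type v} [DecidableEq ι] (e : ι → A) (M : Type w)
    [AddCommGroup M] [Module k M] [Module (Unitization k A) M] [IsScalarTower k (Unitization k A) M] : Prop :=
  DirectSum.IsInternal fun i => LinearMap.range (Algebra.lsmul k k M (e i : Unitization k A))

/-- A linear graded projective resolution
`⋯ → P 2 → P 1 → P 0 → S → 0` of a module `S` placed in degree `0`: every `P i` is a graded
(locally unital) projective module generated by its component of degree `i`, and all maps preserve
degrees. Since `A` is graded by the natural numbers, such a `P i` has no components of negative
degree. For a locally unital module, projectivity over `Unitization k A` is the same as projectivity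
in the category of locally unital modules, because `A e_i = (Unitization k A) e_i`. -/
structure LinearResolution {k A : Type u} [Field k] [NonUnitalRing A] [Module k A]
    [IsScalarTower k A A] [SMulCommClass k A A] {ι : Type v} [DecidableEq ι] (e : ι → A)
    (𝒜 : ℕ → Submodule k A) (S : Type w) [AddCommGroup S] [Module (Unitization k A) S] where
  P : ℕ → Type u
  [addCommGroup : ∀ i, AddCommGroup (P i)]
  [moduleBase : ∀ i, Module k (P i)]
  [module : ∀ i, Module (Unitization k A) (P i)]
  [isScalarTower : ∀ i, IsScalarTower k (Unitization k A) (P i)]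
  locallyUnital : ∀ i, IsLocallyUnital (k := k) e (P i)
  projective : ∀ i, Module.Projective (Unitization k A) (P i)
  /-- `grading i j` is the component of degree `j` of `P i`. -/
  grading : ∀ i, ℕ → Submodule k (P i)
  isInternal : ∀ i, DirectSum.IsInternal (grading i)
  smul_mem : ∀ i j l, ∀ a ∈ 𝒜 j, ∀ x ∈ grading i l, (a : Unitization k A) • x ∈ grading i (j + l)
  generated : ∀ i, Submodule.span (Unitization k A) (grading i i : Set (P i)) = ⊤
  d : ∀ i, P (i + 1) →ₗ[Unitization k A] P i
  d_mem : ∀ i j, ∀ x ∈ grading (i + 1) j, d i x ∈ grading i j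
  augmentation : P 0 →ₗ[Unitization k A] S
  augmentation_eq_zero : ∀ j, j ≠ 0 → ∀ x ∈ grading 0 j, augmentation x = 0
  augmentation_surjective : Function.Surjective augmentation
  exact_zero : Function.Exact (d 0) augmentation
  exact_succ : ∀ i, Function.Exact (d (i + 1)) (d i)

/-- Koszulity of a graded locally unital algebra `A = ⨁ e_i A e_j`: it is graded by the natural
numbers, its component of degree zero is the semisimple algebra `⨁ k e_i`, and every simple module
concentrated in degree zero has a linear graded projective resolution. -/
structure IsKoszulAlgebra {k A : Type u} [Field k] [NonUnitalRing A] [Module k A]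
    [IsScalarTower k A A] [SMulCommClass k A A] {ι : Type v} [DecidableEq ι] (e : ι → A)
    (𝒜 : ℕ → Submodule k A) : Prop where
  ne_zero : ∀ i, e i ≠ 0
  idempotent : ∀ i, e i * e i = e i
  orthogonal : ∀ i j, i ≠ j → e i * e j = 0
  peirce : DirectSum.IsInternal fun p : ι × ι =>
    LinearMap.range (LinearMap.mulLeft k (e p.1) ∘ₗ LinearMap.mulRight k (e p.2))
  isInternal : DirectSum.IsInternal 𝒜
  mul_mem : ∀ i j, ∀ a ∈ 𝒜 i, ∀ b ∈ 𝒜 j, a * b ∈ 𝒜 (i + j)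
  degree_zero : 𝒜 0 = Submodule.span k (Set.range e)
  linear : ∀ (S : Type w) [AddCommGroup S] [Module k S] [Module (Unitization k A) S]
    [IsScalarTower k (Unitization k A) S], IsSimpleModule (Unitization k A) S →
    IsLocallyUnital (k := k) e S →
    (∀ i, i ≠ 0 → ∀ a ∈ 𝒜 i, ∀ s : S, (a : Unitization k A) • s = 0) →
    Nonempty (LinearResolution (k := k) e 𝒜 S)

/-! ### The simple modules over the algebra of slarcs -/

/-- The one-dimensional module `L_n = k 1_n`, on which `1_n` acts as the identity and every other
diagram acts by zero. -/
def SlarcSimple (k : Type u) [Field k] (_n : ℕ) : Type u := k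

namespace SlarcSimple

noncomputable section

variable (k : Type u) [Field k] (n : ℕ)

instance : AddCommGroup (SlarcSimple k n) := inferInstanceAs (AddCommGroup k)

instance : Module k (SlarcSimple k n) := inferInstanceAs (Module k k)

instance : Module (Unitization k (SlarcAlgebra k)) (SlarcSimple k n) :=
  Module.compHom k (Unitization.lift (SlarcAlgebra.coeffOne k n)).toRingHom

lemma smul_def (a : Unitization k (SlarcAlgebra k)) (s : SlarcSimple k n) :
    a • s = (Unitization.lift (SlarcAlgebra.coeffOne k n) a : k) • s := rfl

instance : IsScalarTower k (Unitization k (SlarcAlgebra k)) (SlarcSimple k n) where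
  smul_assoc c a s := by
    rw [smul_def, smul_def, map_smul, smul_assoc]

end

end SlarcSimple

/-!
The left module structure of `A⁻ 1_r` only sees left points, so a basis element of the term of
homological degree `i` in the resolution of `L_n` is encoded by the number `m` of left points and a
word. A letter is a larc, given by its left point, or a sarc; the left points of the larcs increase.
Exactly `n` letters are distinguished, some sarcs are marked, and `i` is the number of letters that
are not distinguished plus the number of marked sarcs. The unmarked letters are the right points of
the diagram. The differential is the signed derivation that deletes larcs that are not distinguished
and unmarks marked sarcs; either way the diagram gains exactly one sarc.

Forgetting the left action, the complex splits over `m`, and has a contracting homotopy: if the word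
contains a sarc, mark the first one; otherwise insert, if it is free, the first left point that is
not the end of a distinguished larc. This only fails at the word consisting of `n = m` distinguished
larcs, which survives as `L_n`.

For a simple module `S`, choose `n` minimal with `1_n S ≠ 0`. A diagram from `n` points to `n`
points other than `1_n` factors through fewer points and hence kills `S`, so that `S ≅ L_n`.
-/

namespace SlarcDiagram

/-! ### Counting arcs -/

/-- The left points that are ends of long arcs. -/
def leftEnds (x : SlarcDiagram) : Finset ℕ := x.larcs.image Prod.fst

/-- The right points that are ends of long arcs. -/
def rightEnds (x : SlarcDiagram) : Finset ℕ := x.larcs.image Prod.snd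

lemma mem_leftEnds {x : SlarcDiagram} {i : ℕ} : i ∈ x.leftEnds ↔ ∃ j, (i, j) ∈ x.larcs := by
  simp [leftEnds]

lemma mem_rightEnds {x : SlarcDiagram} {j : ℕ} : j ∈ x.rightEnds ↔ ∃ i, (i, j) ∈ x.larcs := by
  simp [rightEnds]

lemma injOn_fst_larcs (x : SlarcDiagram) : Set.InjOn Prod.fst (x.larcs : Set (ℕ × ℕ)) :=
  fun _ hp _ hq h => Prod.ext h (x.larc_eq_left hp (by rw [h]; exact hq))

lemma injOn_snd_larcs (x : SlarcDiagram) : Set.InjOn Prod.snd (x.larcs : Set (ℕ × ℕ)) :=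
  fun _ hp _ hq h => Prod.ext (x.larc_eq_right hp (by rw [h]; exact hq)) h

lemma card_leftEnds (x : SlarcDiagram) : x.leftEnds.card = x.larcs.card :=
  Finset.card_image_of_injOn x.injOn_fst_larcs

lemma card_rightEnds (x : SlarcDiagram) : x.rightEnds.card = x.larcs.card :=
  Finset.card_image_of_injOn x.injOn_snd_larcs

lemma leftEnds_subset_range (x : SlarcDiagram) : x.leftEnds ⊆ Finset.range x.left :=
  Finset.image_subset_iff.2 fun p hp => Finset.mem_range.2 (x.left_lt p hp)

lemma rightEnds_subset_range (x : SlarcDiagram) : x.rightEnds ⊆ Finset.range x.right :=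
  Finset.image_subset_iff.2 fun p hp => Finset.mem_range.2 (x.right_lt p hp)

lemma leftSarcs_eq_sdiff (x : SlarcDiagram) : x.leftSarcs = Finset.range x.left \ x.leftEnds := by
  ext i
  simp only [leftSarcs, leftEnds, Finset.mem_filter, Finset.mem_sdiff, Finset.mem_image]
  grind

lemma rightSarcs_eq_sdiff (x : SlarcDiagram) :
    x.rightSarcs = Finset.range x.right \ x.rightEnds := by
  ext j
  simp only [rightSarcs, rightEnds, Finset.mem_filter, Finset.mem_sdiff, Finset.mem_image]
  grind

lemma card_leftSarcs_add_card_larcs (x : SlarcDiagram) :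
    x.leftSarcs.card + x.larcs.card = x.left := by
  rw [leftSarcs_eq_sdiff, ← card_leftEnds,
    Finset.card_sdiff_add_card_eq_card x.leftEnds_subset_range, Finset.card_range]

lemma card_rightSarcs_add_card_larcs (x : SlarcDiagram) :
    x.rightSarcs.card + x.larcs.card = x.right := by
  rw [rightSarcs_eq_sdiff, ← card_rightEnds,
    Finset.card_sdiff_add_card_eq_card x.rightEnds_subset_range, Finset.card_range]

lemma numSarcs_add_two_mul_card_larcs (x : SlarcDiagram) :
    x.numSarcs + 2 * x.larcs.card = x.left + x.right := by
  have := x.card_leftSarcs_add_card_larcs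
  have := x.card_rightSarcs_add_card_larcs
  unfold numSarcs
  lia

lemma rightEnds_union_leftEnds_of_composable {x y : SlarcDiagram} (h : Composable x y) :
    x.rightEnds ∪ y.leftEnds = Finset.range y.left := by
  obtain ⟨hxy, hends⟩ := composable_iff.1 h
  refine (Finset.union_subset (hxy ▸ x.rightEnds_subset_range)
    y.leftEnds_subset_range).antisymm fun l hl => ?_
  rw [Finset.mem_union, mem_rightEnds, mem_leftEnds]
  exact hends l (Finset.mem_range.1 hl)

lemma card_larcs_concat (x y : SlarcDiagram) :
    (concat x y).larcs.card = (x.rightEnds ∩ y.leftEnds).card := by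
  have hmid : ∀ p ∈ (concat x y).larcs, ∃ l, (p.1, l) ∈ x.larcs ∧ (l, p.2) ∈ y.larcs :=
    fun p hp => mem_concat.1 hp
  choose! mid hx hy using hmid
  refine Finset.card_bij (fun p _ => mid p) (fun p hp => ?_) (fun p hp q hq h => ?_)
    fun l hl => ?_
  · exact Finset.mem_inter.2 ⟨mem_rightEnds.2 ⟨_, hx p hp⟩, mem_leftEnds.2 ⟨_, hy p hp⟩⟩
  · change mid p = mid q at h
    exact Prod.ext (x.larc_eq_right (hx p hp) (h ▸ hx q hq))
      (y.larc_eq_left (hy p hp) (h ▸ hy q hq))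
  · rw [Finset.mem_inter, mem_rightEnds, mem_leftEnds] at hl
    obtain ⟨⟨i, hi⟩, j, hj⟩ := hl
    have hij : (i, j) ∈ (concat x y).larcs := mem_concat.2 ⟨l, hi, hj⟩
    exact ⟨(i, j), hij, x.larc_eq_left (hx _ hij) hi⟩

lemma numSarcs_concat {x y : SlarcDiagram} (h : Composable x y) :
    (concat x y).numSarcs = x.numSarcs + y.numSarcs := by
  have hcard := Finset.card_union_add_card_inter x.rightEnds y.leftEnds
  rw [rightEnds_union_leftEnds_of_composable h, ← card_larcs_concat, card_rightEnds,
    card_leftEnds, Finset.card_range] at hcard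
  have hx := x.numSarcs_add_two_mul_card_larcs
  have hy := y.numSarcs_add_two_mul_card_larcs
  have hxy : (concat x y).numSarcs + 2 * (concat x y).larcs.card = x.left + y.right :=
    (concat x y).numSarcs_add_two_mul_card_larcs
  have hmid := h.1
  lia

/-! ### Factorization through the long arcs -/

/-- The number of long arcs below the arc `p`. -/
def rank (x : SlarcDiagram) (p : ℕ × ℕ) : ℕ := (x.larcs.filter fun q => q.2 < p.2).card

lemma rank_lt_card {x : SlarcDiagram} {p : ℕ × ℕ} (hp : p ∈ x.larcs) :
    x.rank p < x.larcs.card :=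
  Finset.card_lt_card (Finset.filter_ssubset.2 ⟨p, hp, lt_irrefl _⟩)

lemma rank_lt_rank_iff {x : SlarcDiagram} {p q : ℕ × ℕ} (hp : p ∈ x.larcs) :
    x.rank p < x.rank q ↔ p.2 < q.2 := by
  refine ⟨fun h => ?_, fun h => Finset.card_lt_card ?_⟩
  · by_contra! hqp
    exact h.not_ge (Finset.card_le_card (Finset.monotone_filter_right _
      fun r _ (hr : r.2 < q.2) => hr.trans_le hqp))
  · refine Finset.ssubset_iff_of_subset (Finset.monotone_filter_right _
      fun r _ (hr : r.2 < p.2) => hr.trans h) |>.2 ⟨p, Finset.mem_filter.2 ⟨hp, h⟩, ?_⟩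
    simp

lemma injOn_rank (x : SlarcDiagram) : Set.InjOn x.rank (x.larcs : Set (ℕ × ℕ)) := by
  intro p hp q hq h
  have hpq := (rank_lt_rank_iff (q := q) hp).not.1 h.not_lt
  have hqp := (rank_lt_rank_iff (q := p) hq).not.1 h.not_gt
  exact x.injOn_snd_larcs hp hq (by lia)

lemma image_rank (x : SlarcDiagram) : x.larcs.image x.rank = Finset.range x.larcs.card :=
  Finset.eq_of_subset_of_card_le
    (Finset.image_subset_iff.2 fun _ hp => Finset.mem_range.2 (rank_lt_card hp))
    (by rw [Finset.card_image_of_injOn x.injOn_rank, Finset.card_range])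

/-- The left factor of the factorization of `x` through as many points as `x` has long arcs. -/
def leftFactor (x : SlarcDiagram) : SlarcDiagram where
  left := x.left
  right := x.larcs.card
  larcs := x.larcs.image fun p => (p.1, x.rank p)
  left_lt := by
    rw [Finset.forall_mem_image]
    exact x.left_lt
  right_lt := by
    rw [Finset.forall_mem_image]
    exact fun _ => rank_lt_card
  planar := by
    simp only [Finset.forall_mem_image]
    exact fun p hp q hq => (x.planar p hp q hq).trans (rank_lt_rank_iff hp).symm

/-- The right factor of the factorization of `x` through as many points as `x` has long arcs. -/
def rightFactor (x : SlarcDiagram) : SlarcDiagram where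
  left := x.larcs.card
  right := x.right
  larcs := x.larcs.image fun p => (x.rank p, p.2)
  left_lt := by
    rw [Finset.forall_mem_image]
    exact fun _ => rank_lt_card
  right_lt := by
    rw [Finset.forall_mem_image]
    exact x.right_lt
  planar := by
    simp only [Finset.forall_mem_image]
    exact fun _ hp _ _ => rank_lt_rank_iff hp

lemma composable_leftFactor_rightFactor (x : SlarcDiagram) :
    Composable x.leftFactor x.rightFactor := by
  refine composable_iff.2 ⟨rfl, fun l (hl : l < x.larcs.card) => Or.inl ?_⟩
  rw [← Finset.mem_range, ← image_rank, Finset.mem_image] at hl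
  obtain ⟨p, hp, rfl⟩ := hl
  exact ⟨p.1, Finset.mem_image_of_mem _ hp⟩

lemma concat_leftFactor_rightFactor (x : SlarcDiagram) :
    concat x.leftFactor x.rightFactor = x := by
  ext1
  · rfl
  · rfl
  · ext ⟨i, j⟩
    rw [mem_concat]
    constructor
    · rintro ⟨l, hl, hr⟩
      obtain ⟨p, hp, hpl⟩ := Finset.mem_image.1 hl
      obtain ⟨q, hq, hql⟩ := Finset.mem_image.1 hr
      rw [Prod.mk.injEq] at hpl hql
      obtain rfl : p = q := x.injOn_rank hp hq (hpl.2.trans hql.1.symm)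
      rwa [← hpl.1, ← hql.2]
    · exact fun h => ⟨x.rank (i, j), Finset.mem_image.2 ⟨_, h, rfl⟩,
        Finset.mem_image.2 ⟨_, h, rfl⟩⟩

/-! ### The identity diagrams -/

lemma rank_eq_snd {x : SlarcDiagram} (h : x.larcs.card = x.right) {p : ℕ × ℕ}
    (hp : p ∈ x.larcs) : x.rank p = p.2 := by
  have hends : x.rightEnds = Finset.range x.right :=
    Finset.eq_of_subset_of_card_le x.rightEnds_subset_range
      (by rw [card_rightEnds, h, Finset.card_range])
  have hbelow : x.rightEnds.filter (· < p.2) = Finset.range p.2 := by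
    ext j
    have := x.right_lt p hp
    rw [hends, Finset.mem_filter, Finset.mem_range, Finset.mem_range]
    lia
  rw [rank, ← Finset.card_image_of_injOn (x.injOn_snd_larcs.mono (Finset.filter_subset _ _)),
    ← Finset.filter_image (p := (· < p.2)), ← rightEnds, hbelow, Finset.card_range]

lemma rank_eq_fst {x : SlarcDiagram} (h : x.larcs.card = x.left) {p : ℕ × ℕ}
    (hp : p ∈ x.larcs) : x.rank p = p.1 := by
  have hends : x.leftEnds = Finset.range x.left :=
    Finset.eq_of_subset_of_card_le x.leftEnds_subset_range
      (by rw [card_leftEnds, h, Finset.card_range])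
  have hbelow : x.leftEnds.filter (· < p.1) = Finset.range p.1 := by
    ext i
    have := x.left_lt p hp
    rw [hends, Finset.mem_filter, Finset.mem_range, Finset.mem_range]
    lia
  rw [rank, ← Finset.filter_congr fun q hq => x.planar q hq p hp,
    ← Finset.card_image_of_injOn (x.injOn_fst_larcs.mono (Finset.filter_subset _ _)),
    ← Finset.filter_image (p := (· < p.1)), ← leftEnds, hbelow, Finset.card_range]

lemma eq_one_of_card_larcs {x : SlarcDiagram} (hleft : x.larcs.card = x.left)
    (hright : x.larcs.card = x.right) : x = one x.larcs.card := by
  ext1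
  · exact hleft.symm
  · exact hright.symm
  · refine Finset.eq_of_subset_of_card_le (fun p hp => ?_) ?_
    · rw [← Prod.mk.eta (p := p), mem_one]
      exact ⟨(rank_eq_fst hleft hp).symm.trans (rank_eq_snd hright hp), hleft ▸ x.left_lt p hp⟩
    · exact Finset.card_image_le.trans (Finset.card_range _).le

lemma card_larcs_one (n : ℕ) : (one n).larcs.card = n := by
  rw [one, Finset.card_image_of_injective _ fun _ _ h => congrArg Prod.fst h, Finset.card_range]

lemma numSarcs_eq_zero_iff {x : SlarcDiagram} : x.numSarcs = 0 ↔ ∃ n, x = one n := by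
  constructor
  · intro h
    have := x.card_leftSarcs_add_card_larcs
    have := x.card_rightSarcs_add_card_larcs
    unfold numSarcs at h
    exact ⟨_, eq_one_of_card_larcs (by lia) (by lia)⟩
  · rintro ⟨n, rfl⟩
    have h : (one n).numSarcs + 2 * (one n).larcs.card = n + n :=
      (one n).numSarcs_add_two_mul_card_larcs
    rw [card_larcs_one] at h
    lia

lemma numSarcs_one (n : ℕ) : (one n).numSarcs = 0 := numSarcs_eq_zero_iff.2 ⟨n, rfl⟩

lemma one_composable_iff {n : ℕ} {x : SlarcDiagram} : Composable (one n) x ↔ n = x.left := by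
  refine composable_iff.trans ⟨And.left, ?_⟩
  rintro rfl
  exact ⟨rfl, fun l hl => Or.inl ⟨l, mem_one.2 ⟨rfl, hl⟩⟩⟩

lemma composable_one_iff {n : ℕ} {x : SlarcDiagram} : Composable x (one n) ↔ x.right = n := by
  refine composable_iff.trans ⟨And.left, ?_⟩
  rintro rfl
  exact ⟨rfl, fun l hl => Or.inr ⟨l, mem_one.2 ⟨rfl, hl⟩⟩⟩

lemma one_concat (x : SlarcDiagram) : concat (one x.left) x = x := by
  ext1
  · rfl
  · rfl
  · ext ⟨i, j⟩
    have := x.left_lt (i, j)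
    simp only [mem_concat, mem_one]
    grind

lemma concat_one (x : SlarcDiagram) : concat x (one x.right) = x := by
  ext1
  · rfl
  · rfl
  · ext ⟨i, j⟩
    have := x.right_lt (i, j)
    simp only [mem_concat, mem_one]
    grind

end SlarcDiagram

/-! ### Parts of a basis -/

section Basis

variable {R M X κ : Type*} [Ring R] [AddCommGroup M] [Module R M] [DecidableEq κ]

lemma isInternal_span_basis_image_fiber (b : Module.Basis X R M) (f : X → κ) :
    DirectSum.IsInternal fun j => Submodule.span R (b '' {x | f x = j}) := by
  apply DirectSum.isInternal_submodule_of_iSupIndep_of_iSup_eq_top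
  · intro j
    have hle : (⨆ i, ⨆ (_ : i ≠ j), Submodule.span R (b '' {x | f x = i})) ≤
        Submodule.span R (b '' {x | f x ≠ j}) :=
      iSup₂_le fun i hi => Submodule.span_mono (Set.image_mono fun _ hx => hx.trans_ne hi)
    refine Disjoint.mono_right hle (b.linearIndependent.disjoint_span_image ?_)
    exact Set.disjoint_left.2 fun _ hx hx' => hx' hx
  · rw [eq_top_iff, ← b.span_eq, Submodule.span_le]
    rintro _ ⟨x, rfl⟩
    exact Submodule.mem_iSup_of_mem (f x) (Submodule.subset_span ⟨x, rfl, rfl⟩)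

lemma range_eq_span_basis_image_fiber (b : Module.Basis X R M) (f : X → κ) (j : κ)
    (T : M →ₗ[R] M) (hT : ∀ x, T (b x) = if f x = j then b x else 0) :
    LinearMap.range T = Submodule.span R (b '' {x | f x = j}) := by
  rw [LinearMap.range_eq_map, ← b.span_eq, Submodule.map_span]
  apply le_antisymm
  · rw [Submodule.span_le]
    rintro _ ⟨_, ⟨x, rfl⟩, rfl⟩
    rw [hT]
    split_ifs with h
    · exact Submodule.subset_span ⟨x, h, rfl⟩
    · exact Submodule.zero_mem _
  · refine Submodule.span_mono ?_
    rintro _ ⟨x, hx, rfl⟩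
    exact ⟨b x, ⟨x, rfl⟩, by rw [hT]; exact if_pos hx⟩

end Basis

section Finsupp

variable {R α M : Type*} [Semiring R] [AddCommMonoid M] [Module R M] {s : Set α}
  {f g : (α →₀ R) →ₗ[R] M}

lemma apply_mem_of_mem_supported {p : Submodule R M}
    (h : ∀ a ∈ s, f (Finsupp.single a 1) ∈ p) {q : α →₀ R} (hq : q ∈ Finsupp.supported R R s) :
    f q ∈ p := by
  have hle : Finsupp.supported R R s ≤ p.comap f := by
    rw [Finsupp.supported_eq_span_single, Submodule.span_le]
    rintro _ ⟨a, ha, rfl⟩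
    exact h a ha
  exact hle hq

lemma apply_eq_of_mem_supported (h : ∀ a ∈ s, f (Finsupp.single a 1) = g (Finsupp.single a 1))
    {q : α →₀ R} (hq : q ∈ Finsupp.supported R R s) : f q = g q := by
  rw [Finsupp.supported_eq_span_single] at hq
  refine LinearMap.eqOn_span ?_ hq
  rintro _ ⟨a, ha, rfl⟩
  exact h a ha

lemma apply_eq_of_apply_single_eq (h : ∀ a, f (Finsupp.single a 1) = g (Finsupp.single a 1))
    (q : α →₀ R) : f q = g q :=
  apply_eq_of_mem_supported (s := Set.univ) (fun a _ => h a)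
    (Finsupp.supported_univ (R := R) (M := R) ▸ Submodule.mem_top)

end Finsupp

/-! ### The algebra of slarcs is graded and locally unital -/

/-- The algebra of slarcs with a unit adjoined, the ring whose modules are the modules over the
algebra of slarcs. -/
abbrev UnitalSlarcAlgebra (k : Type u) [Field k] : Type u := Unitization k (SlarcAlgebra k)

namespace SlarcAlgebra

open SlarcDiagram

variable (k : Type u) [Field k]

/-- A diagram as an element of the algebra of slarcs with a unit adjoined. -/
noncomputable abbrev unitalDiag (x : SlarcDiagram) : UnitalSlarcAlgebra k := diag k x

variable {k}

lemma diag_mul_diag_of_composable {x y : SlarcDiagram} (h : Composable x y) :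
    diag k x * diag k y = diag k (concat x y) := by
  rw [diag_mul_diag, diagMul, if_pos h]

lemma diag_mul_diag_of_not_composable {x y : SlarcDiagram} (h : ¬ Composable x y) :
    diag k x * diag k y = 0 := by
  rw [diag_mul_diag, diagMul, if_neg h]

lemma idem_mul_diag (n : ℕ) (x : SlarcDiagram) :
    idem k n * diag k x = if x.left = n then diag k x else 0 := by
  split_ifs with h
  · subst h
    rw [idem, diag_mul_diag_of_composable (one_composable_iff.2 rfl), one_concat]
  · exact diag_mul_diag_of_not_composable fun hc => h (one_composable_iff.1 hc).symm

lemma diag_mul_idem (n : ℕ) (x : SlarcDiagram) :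
    diag k x * idem k n = if x.right = n then diag k x else 0 := by
  split_ifs with h
  · subst h
    rw [idem, diag_mul_diag_of_composable (composable_one_iff.2 rfl), concat_one]
  · exact diag_mul_diag_of_not_composable fun hc => h (composable_one_iff.1 hc)

lemma coeffOne_diag (n : ℕ) (x : SlarcDiagram) [Decidable (x = one n)] :
    coeffOne k n (diag k x) = if x = one n then 1 else 0 := by
  classical
  change (basis k).coord (one n) (basis k x) = _
  rw [Module.Basis.coord_apply, Module.Basis.repr_self, Finsupp.single_apply]

variable (k)

lemma isInternal_sarcGrading : DirectSum.IsInternal (sarcGrading k) :=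
  isInternal_span_basis_image_fiber (basis k) numSarcs

lemma isInternal_peirce : DirectSum.IsInternal fun p : ℕ × ℕ =>
    LinearMap.range (LinearMap.mulLeft k (idem k p.1) ∘ₗ LinearMap.mulRight k (idem k p.2)) := by
  have hrange (p : ℕ × ℕ) : LinearMap.range
      (LinearMap.mulLeft k (idem k p.1) ∘ₗ LinearMap.mulRight k (idem k p.2)) =
      Submodule.span k (basis k '' {x | (x.left, x.right) = p}) := by
    refine range_eq_span_basis_image_fiber (basis k) (fun x => (x.left, x.right)) p _ fun x => ?_
    change idem k p.1 * (diag k x * idem k p.2) = if _ then diag k x else 0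
    rw [diag_mul_idem, mul_ite, idem_mul_diag, mul_zero, ← ite_and]
    exact if_congr (by rw [Prod.ext_iff, and_comm]) rfl rfl
  simp only [hrange]
  exact isInternal_span_basis_image_fiber (basis k) fun x => (x.left, x.right)

variable {k} in
lemma mul_mem_sarcGrading {i j : ℕ} {a b : SlarcAlgebra k} (ha : a ∈ sarcGrading k i)
    (hb : b ∈ sarcGrading k j) : a * b ∈ sarcGrading k (i + j) := by
  refine LinearMap.BilinMap.apply_apply_mem_of_mem_span _ _ _ (LinearMap.mul k _) ?_ a b ha hb
  rintro _ ⟨x, rfl, rfl⟩ _ ⟨y, rfl, rfl⟩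
  rw [LinearMap.mul_apply']
  by_cases h : Composable x y
  · rw [diag_mul_diag_of_composable h]
    exact Submodule.subset_span ⟨_, numSarcs_concat h, rfl⟩
  · rw [diag_mul_diag_of_not_composable h]
    exact Submodule.zero_mem _

lemma sarcGrading_zero : sarcGrading k 0 = Submodule.span k (Set.range (idem k)) := by
  have h : {x : SlarcDiagram | x.numSarcs = 0} = Set.range one := by
    ext x
    rw [Set.mem_ofPred_eq, numSarcs_eq_zero_iff]
    exact exists_congr fun n => eq_comm
  rw [sarcGrading, h, ← Set.range_comp]
  rfl

/-! ### Modules over the algebra of slarcs -/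

variable {k}

/-- A map from the diagrams to an algebra that is multiplicative, with `0` as the product of
diagrams that cannot be concatenated, extends to the algebra of slarcs. -/
noncomputable def lift {B : Type*} [NonUnitalRing B] [Module k B] [IsScalarTower k B B]
    [SMulCommClass k B B] (φ : SlarcDiagram → B)
    (hφ : ∀ x y, Composable x y → φ x * φ y = φ (concat x y))
    (hφ_zero : ∀ x y, ¬ Composable x y → φ x * φ y = 0) : SlarcAlgebra k →ₙₐ[k] B where
  __ := (basis k).constr k φ
  map_zero' := map_zero ((basis k).constr k φ)
  map_mul' := by
    have hdiag : ∀ x, (basis k).constr k φ (diag k x) = φ x := (basis k).constr_basis k φ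
    have hmul : (LinearMap.mul k (SlarcAlgebra k)).compr₂ ((basis k).constr k φ) =
        (LinearMap.mul k B).compl₁₂ ((basis k).constr k φ) ((basis k).constr k φ) := by
      refine LinearMap.ext_basis (basis k) (basis k) fun x y => ?_
      change (basis k).constr k φ (diag k x * diag k y) =
        (basis k).constr k φ (diag k x) * (basis k).constr k φ (diag k y)
      rw [hdiag, hdiag]
      by_cases h : Composable x y
      · rw [diag_mul_diag_of_composable h, hdiag, hφ x y h]
      · rw [diag_mul_diag_of_not_composable h, map_zero, hφ_zero x y h]
    exact fun a b => LinearMap.congr_fun₂ hmul a b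

@[simp] lemma lift_diag {B : Type*} [NonUnitalRing B] [Module k B] [IsScalarTower k B B]
    [SMulCommClass k B B] (φ : SlarcDiagram → B)
    (hφ : ∀ x y, Composable x y → φ x * φ y = φ (concat x y))
    (hφ_zero : ∀ x y, ¬ Composable x y → φ x * φ y = 0) (x : SlarcDiagram) :
    lift φ hφ hφ_zero (diag k x) = φ x :=
  (basis k).constr_basis k φ x

lemma unital_induction {p : UnitalSlarcAlgebra k → Prop} (one : p 1)
    (unitalDiag : ∀ x, p (unitalDiag k x)) (add : ∀ a b, p a → p b → p (a + b))
    (smul : ∀ (c : k) a, p a → p (c • a)) (a : UnitalSlarcAlgebra k) : p a := by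
  induction a using Unitization.ind with
  | inl_add_inr c a =>
    refine add _ _ ?_ ?_
    · rw [← Unitization.algebraMap_eq_inl, Algebra.algebraMap_eq_smul_one]
      exact smul c 1 one
    · induction a using diag_induction with
      | hd x => exact unitalDiag x
      | h0 => simpa only [zero_smul, Unitization.inr_zero] using smul 0 1 one
      | ha a b ha hb => simpa only [Unitization.inr_add] using add _ _ ha hb
      | hs c a ha => simpa only [Unitization.inr_smul] using smul c _ ha

section Module

variable {M : Type*} [AddCommGroup M] [Module (UnitalSlarcAlgebra k) M]

lemma unitalDiag_smul_smul_of_composable {x y : SlarcDiagram} (h : Composable x y) (m : M) :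
    unitalDiag k x • unitalDiag k y • m = unitalDiag k (concat x y) • m := by
  rw [← mul_smul, ← Unitization.inr_mul, diag_mul_diag_of_composable h]

lemma unitalDiag_smul_smul_of_not_composable {x y : SlarcDiagram} (h : ¬ Composable x y)
    (m : M) : unitalDiag k x • unitalDiag k y • m = 0 := by
  rw [← mul_smul, ← Unitization.inr_mul, diag_mul_diag_of_not_composable h, Unitization.inr_zero,
    zero_smul]

variable [Module k M] [IsScalarTower k (UnitalSlarcAlgebra k) M]
  {N : Type*} [AddCommGroup N] [Module k N] [Module (UnitalSlarcAlgebra k) N]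
  [IsScalarTower k (UnitalSlarcAlgebra k) N]

/-- A `k`-linear map commuting with the diagrams, as a homomorphism of modules over the algebra of
slarcs. -/
def linearMapOfCommDiag (f : M →ₗ[k] N)
    (hf : ∀ x m, f (unitalDiag k x • m) = unitalDiag k x • f m) :
    M →ₗ[UnitalSlarcAlgebra k] N where
  toFun := f
  map_add' := map_add f
  map_smul' a m := by
    rw [RingHom.id_apply]
    induction a using unital_induction with
    | one => rw [one_smul, one_smul]
    | unitalDiag x => exact hf x m
    | add a b ha hb => rw [add_smul, add_smul, map_add, ha, hb]
    | smul c a ha => rw [smul_assoc, smul_assoc, map_smul, ha]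

@[simp] lemma linearMapOfCommDiag_apply (f : M →ₗ[k] N)
    (hf : ∀ x m, f (unitalDiag k x • m) = unitalDiag k x • f m) (m : M) :
    linearMapOfCommDiag f hf m = f m := rfl

end Module

end SlarcAlgebra

/-! ### Modules with a basis permuted by the diagrams -/

open SlarcDiagram SlarcAlgebra

/-- A set on which diagrams act freely: each element `w` is obtained in a unique way by letting
a diagram, `diagram w`, act on a generator, `gen w`. The value of `act x w` only matters if
`x` and `diagram w` are composable. -/
class DiagramSet (X : Type v) where
  diagram : X → SlarcDiagram
  act : SlarcDiagram → X → X
  gen : X → X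
  diagram_act : ∀ {x w}, Composable x (diagram w) → diagram (act x w) = concat x (diagram w)
  act_act : ∀ {x y w}, Composable y (diagram w) → act x (act y w) = act (concat x y) w
  gen_act : ∀ {x w}, Composable x (diagram w) → gen (act x w) = gen w
  diagram_gen : ∀ w, diagram (gen w) = one (diagram w).right
  act_gen : ∀ w, act (diagram w) (gen w) = w

namespace DiagramSet

variable {X : Type v} [DiagramSet X]

lemma composable_diagram_gen (w : X) : Composable (diagram w) (diagram (gen w)) := by
  rw [diagram_gen]
  exact composable_one_iff.2 rfl

lemma composable_diagram_act {x y : SlarcDiagram} {w : X} (h : Composable y (diagram w)) :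
    Composable x (diagram (act y w)) ↔ Composable x y ∧ Composable (concat x y) (diagram w) := by
  rw [diagram_act h, composable_assoc x y (diagram w), and_iff_right h]

lemma one_act (w : X) : act (one (diagram w).left) w = w := by
  rw [← act_gen w, act_act (composable_diagram_gen w), act_gen, one_concat, act_gen]

end DiagramSet

/-- The vector space with basis a set on which diagrams act, a module over the algebra of slarcs. -/
def DiagramModule (k : Type u) [Field k] (X : Type v) : Type (max u v) := X →₀ k

namespace DiagramModule

open DiagramSet

noncomputable section

variable (k : Type u) [Field k] (X : Type v)

instance : AddCommGroup (DiagramModule k X) := inferInstanceAs (AddCommGroup (X →₀ k))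

instance : Module k (DiagramModule k X) := inferInstanceAs (Module k (X →₀ k))

/-- The basis of a diagram module. -/
def basis : Module.Basis X k (DiagramModule k X) :=
  Module.Basis.ofRepr (LinearEquiv.refl k (X →₀ k))

variable {X} [DiagramSet X]

open Classical in
/-- The action of a diagram on a diagram module: it kills the basis vectors with which it is not
composable. -/
def diagAction (x : SlarcDiagram) : Module.End k (DiagramModule k X) :=
  (basis k X).constr k fun w => if Composable x (diagram w) then basis k X (act x w) else 0

variable {k}

lemma diagAction_basis_of_composable {x : SlarcDiagram} {w : X} (h : Composable x (diagram w)) :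
    diagAction k x (basis k X w) = basis k X (act x w) := by
  rw [diagAction, Module.Basis.constr_basis, if_pos h]

lemma diagAction_basis_of_not_composable {x : SlarcDiagram} {w : X}
    (h : ¬ Composable x (diagram w)) : diagAction k x (basis k X w) = 0 := by
  rw [diagAction, Module.Basis.constr_basis, if_neg h]

lemma diagAction_mul_of_composable {x y : SlarcDiagram} (hxy : Composable x y) :
    diagAction k (X := X) x * diagAction k y = diagAction k (concat x y) := by
  refine (basis k X).ext fun w => ?_
  rw [Module.End.mul_apply]
  by_cases hc : Composable (concat x y) (diagram w)
  · have hy := ((composable_assoc x y _).1 ⟨hxy, hc⟩).1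
    rw [diagAction_basis_of_composable hy, diagAction_basis_of_composable hc,
      diagAction_basis_of_composable ((composable_diagram_act hy).2 ⟨hxy, hc⟩), act_act hy]
  · rw [diagAction_basis_of_not_composable hc]
    by_cases hy : Composable y (diagram w)
    · rw [diagAction_basis_of_composable hy, diagAction_basis_of_not_composable fun h =>
        hc ((composable_diagram_act hy).1 h).2]
    · rw [diagAction_basis_of_not_composable hy, map_zero]

lemma diagAction_mul_of_not_composable {x y : SlarcDiagram} (hxy : ¬ Composable x y) :
    diagAction k (X := X) x * diagAction k y = 0 := by
  refine (basis k X).ext fun w => ?_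
  rw [Module.End.mul_apply, LinearMap.zero_apply]
  by_cases hy : Composable y (diagram w)
  · rw [diagAction_basis_of_composable hy, diagAction_basis_of_not_composable fun h =>
      hxy ((composable_diagram_act hy).1 h).1]
  · rw [diagAction_basis_of_not_composable hy, map_zero]

variable (k X) in
/-- The action of the algebra of slarcs on a diagram module. -/
def algebraAction : SlarcAlgebra k →ₙₐ[k] Module.End k (DiagramModule k X) :=
  SlarcAlgebra.lift (diagAction k) (fun _ _ => diagAction_mul_of_composable)
    fun _ _ => diagAction_mul_of_not_composable

instance : Module (UnitalSlarcAlgebra k) (DiagramModule k X) :=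
  Module.compHom (DiagramModule k X) (Unitization.lift (algebraAction k X)).toRingHom

lemma smul_def (a : UnitalSlarcAlgebra k) (q : DiagramModule k X) :
    a • q = (Unitization.lift (algebraAction k X) a : Module.End k (DiagramModule k X)) q := rfl

instance : IsScalarTower k (UnitalSlarcAlgebra k) (DiagramModule k X) where
  smul_assoc c a q := by
    rw [smul_def, smul_def, map_smul, LinearMap.smul_apply]

lemma unitalDiag_smul (x : SlarcDiagram) (q : DiagramModule k X) :
    unitalDiag k x • q = diagAction k x q := by
  rw [smul_def, ← Unitization.lift_symm_apply_apply, Equiv.symm_apply_apply, algebraAction,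
    lift_diag]

lemma unitalDiag_smul_basis_of_composable {x : SlarcDiagram} {w : X}
    (h : Composable x (diagram w)) : unitalDiag k x • basis k X w = basis k X (act x w) := by
  rw [unitalDiag_smul, diagAction_basis_of_composable h]

lemma unitalDiag_smul_basis_of_not_composable {x : SlarcDiagram} {w : X}
    (h : ¬ Composable x (diagram w)) : unitalDiag k x • basis k X w = 0 := by
  rw [unitalDiag_smul, diagAction_basis_of_not_composable h]

lemma unitalDiag_diagram_smul_basis_gen (w : X) :
    unitalDiag k (diagram w) • basis k X (gen w) = basis k X w := by
  rw [unitalDiag_smul_basis_of_composable (composable_diagram_gen w), act_gen]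

lemma map_unitalDiag_smul_of_basis {N : Type*} [AddCommGroup N] [Module k N]
    [Module (UnitalSlarcAlgebra k) N] [IsScalarTower k (UnitalSlarcAlgebra k) N]
    (f : DiagramModule k X →ₗ[k] N) (x : SlarcDiagram)
    (h : ∀ w, f (unitalDiag k x • basis k X w) = unitalDiag k x • f (basis k X w))
    (q : DiagramModule k X) : f (unitalDiag k x • q) = unitalDiag k x • f q := by
  have hcomm : f ∘ₗ Algebra.lsmul k k (DiagramModule k X) (unitalDiag k x) =
      Algebra.lsmul k k N (unitalDiag k x) ∘ₗ f := (basis k X).ext h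
  exact LinearMap.congr_fun hcomm q

variable (k X)

lemma isLocallyUnital : IsLocallyUnital (k := k) (idem k) (DiagramModule k X) := by
  have hrange (n : ℕ) : LinearMap.range (Algebra.lsmul k k (DiagramModule k X)
      (idem k n : UnitalSlarcAlgebra k)) =
      Submodule.span k (basis k X '' {w | (diagram w).left = n}) := by
    refine range_eq_span_basis_image_fiber (basis k X) (fun w => (diagram w).left) n _ fun w => ?_
    change unitalDiag k (one n) • basis k X w = _
    split_ifs with h
    · rw [unitalDiag_smul_basis_of_composable (one_composable_iff.2 h.symm), ← h, one_act]
    · exact unitalDiag_smul_basis_of_not_composable fun hc => h (one_composable_iff.1 hc).symm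
  simp only [IsLocallyUnital, hrange]
  exact isInternal_span_basis_image_fiber (basis k X) fun w => (diagram w).left

/-- The `k`-linear map writing the basis vectors as multiples of the generators; it splits the
projection from a free module and so shows that a diagram module is projective. -/
def expandInGenerators : DiagramModule k X →ₗ[k] (DiagramModule k X →₀ UnitalSlarcAlgebra k) :=
  (basis k X).constr k fun w => Finsupp.single (basis k X (gen w)) (unitalDiag k (diagram w))

variable {k X}

lemma expandInGenerators_basis (w : X) : expandInGenerators k X (basis k X w) =
    Finsupp.single (basis k X (gen w)) (unitalDiag k (diagram w)) := by
  rw [expandInGenerators, Module.Basis.constr_basis]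

lemma expandInGenerators_unitalDiag_smul (x : SlarcDiagram) (q : DiagramModule k X) :
    expandInGenerators k X (unitalDiag k x • q) = unitalDiag k x • expandInGenerators k X q := by
  refine map_unitalDiag_smul_of_basis _ x (fun w => ?_) q
  rw [expandInGenerators_basis, Finsupp.smul_single, smul_eq_mul, ← Unitization.inr_mul]
  by_cases h : Composable x (diagram w)
  · rw [unitalDiag_smul_basis_of_composable h, expandInGenerators_basis, gen_act h, diagram_act h,
      diag_mul_diag_of_composable h]
  · rw [unitalDiag_smul_basis_of_not_composable h, map_zero, diag_mul_diag_of_not_composable h,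
      Unitization.inr_zero, Finsupp.single_zero]

lemma linearCombination_expandInGenerators (q : DiagramModule k X) :
    Finsupp.linearCombination (UnitalSlarcAlgebra k) id (expandInGenerators k X q) = q := by
  have hid : ((Finsupp.linearCombination (UnitalSlarcAlgebra k) id).restrictScalars k :
      (DiagramModule k X →₀ UnitalSlarcAlgebra k) →ₗ[k] DiagramModule k X) ∘ₗ
      expandInGenerators k X = LinearMap.id := by
    refine (basis k X).ext fun w => ?_
    rw [LinearMap.comp_apply, expandInGenerators_basis, LinearMap.restrictScalars_apply,
      Finsupp.linearCombination_single, id, unitalDiag_diagram_smul_basis_gen, LinearMap.id_apply]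
  exact LinearMap.congr_fun hid q

variable (k X)

lemma projective : Module.Projective (UnitalSlarcAlgebra k) (DiagramModule k X) :=
  ⟨linearMapOfCommDiag (expandInGenerators k X) expandInGenerators_unitalDiag_smul,
    linearCombination_expandInGenerators⟩

/-- The grading of a diagram module by the number of short arcs of the diagram, with the generators
placed in degree `i`. -/
def grading (i j : ℕ) : Submodule k (DiagramModule k X) :=
  Submodule.span k (basis k X '' {w | i + (diagram w).numSarcs = j})

lemma isInternal_grading (i : ℕ) : DirectSum.IsInternal (grading k X i) :=
  isInternal_span_basis_image_fiber (basis k X) fun w => i + (diagram w).numSarcs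

variable {k X} in
lemma smul_mem_grading {i j l : ℕ} {a : SlarcAlgebra k} (ha : a ∈ sarcGrading k j)
    {q : DiagramModule k X} (hq : q ∈ grading k X i l) :
    (a : UnitalSlarcAlgebra k) • q ∈ grading k X i (j + l) := by
  refine LinearMap.BilinMap.apply_apply_mem_of_mem_span _ _ _
    ((Algebra.lsmul k k (DiagramModule k X)).toLinearMap ∘ₗ Unitization.inrHom k k _) ?_ a q ha hq
  rintro _ ⟨x, rfl, rfl⟩ _ ⟨w, rfl, rfl⟩
  change unitalDiag k x • basis k X w ∈ _
  by_cases h : Composable x (diagram w)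
  · rw [unitalDiag_smul_basis_of_composable h]
    refine Submodule.subset_span ⟨_, ?_, rfl⟩
    rw [Set.mem_ofPred_eq, diagram_act h, numSarcs_concat h, add_left_comm]
  · rw [unitalDiag_smul_basis_of_not_composable h]
    exact Submodule.zero_mem _

lemma span_grading_eq_top (i : ℕ) :
    Submodule.span (UnitalSlarcAlgebra k) (grading k X i i : Set (DiagramModule k X)) = ⊤ := by
  have hbasis : (⊤ : Submodule k (DiagramModule k X)) ≤ (Submodule.span (UnitalSlarcAlgebra k)
      (grading k X i i : Set (DiagramModule k X))).restrictScalars k := by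
    rw [← (basis k X).span_eq, Submodule.span_le]
    rintro _ ⟨w, rfl⟩
    rw [← unitalDiag_diagram_smul_basis_gen]
    refine Submodule.smul_mem _ _ (Submodule.subset_span ?_)
    refine Submodule.subset_span ⟨_, ?_, rfl⟩
    rw [Set.mem_ofPred_eq, diagram_gen, numSarcs_one, add_zero]
  exact eq_top_iff.2 fun q _ => hbasis (Submodule.mem_top (x := q))

end

end DiagramModule

/-! ### Marked diagrams as words -/

/-- A right point of a diagram together with two flags, or a marked short arc. The point is the end
of the long arc from the left point `a`, or of a short arc. The flag `f` tells whether the letter is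
one of the `n` distinguished ones, and `s` whether the short arc is marked; marked short arcs are
not part of the underlying diagram. -/
inductive SlarcLetter
  | larc (f : Bool) (a : ℕ)
  | sarc (f : Bool) (s : Bool)

namespace SlarcLetter

/-- The homological degree of a letter: letters that are not distinguished and marked short arcs
contribute one each. -/
def degree : SlarcLetter → ℕ
  | larc f _ => cond f 0 1
  | sarc f s => cond f 0 1 + cond s 1 0

/-- The number of distinguished letters, `0` or `1`. -/
def numDist : SlarcLetter → ℕ
  | larc f _ => cond f 1 0
  | sarc f _ => cond f 1 0

/-- The number of right points of the underlying diagram, `0` or `1`. -/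
def numRight : SlarcLetter → ℕ
  | larc _ _ => 1
  | sarc _ s => cond s 0 1

/-- The number of long arcs, `0` or `1`. -/
def numLarcs : SlarcLetter → ℕ
  | larc _ _ => 1
  | sarc _ _ => 0

open Classical in
/-- The action of a diagram on a letter: a long arc is extended by a long arc of the diagram, or
becomes an unmarked short arc. -/
noncomputable def subst (x : SlarcDiagram) : SlarcLetter → SlarcLetter
  | larc f b => if h : ∃ i, (i, b) ∈ x.larcs then larc f h.choose else sarc f false
  | sarc f s => sarc f s

variable {x : SlarcDiagram} {b : ℕ}

lemma subst_larc_of_mem {i : ℕ} (h : (i, b) ∈ x.larcs) (f : Bool) :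
    subst x (larc f b) = larc f i := by
  have hex : ∃ i, (i, b) ∈ x.larcs := ⟨i, h⟩
  rw [subst, dif_pos hex, x.larc_eq_right hex.choose_spec h]

lemma subst_larc_of_notMem (h : ¬ ∃ i, (i, b) ∈ x.larcs) (f : Bool) :
    subst x (larc f b) = sarc f false := by
  rw [subst, dif_neg h]

@[simp] lemma subst_sarc (f s : Bool) : subst x (sarc f s) = sarc f s := rfl

lemma apply_subst {α : Type*} {φ : SlarcLetter → α}
    (hφ : ∀ f a, φ (larc f a) = φ (sarc f false)) (x : SlarcDiagram) (l : SlarcLetter) :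
    φ (subst x l) = φ l := by
  cases l with
  | sarc f s => rfl
  | larc f b =>
    by_cases h : ∃ i, (i, b) ∈ x.larcs
    · rw [subst_larc_of_mem h.choose_spec, hφ, hφ]
    · rw [subst_larc_of_notMem h, hφ]

lemma subst_subst (x y : SlarcDiagram) (l : SlarcLetter) :
    subst x (subst y l) = subst (concat x y) l := by
  cases l with
  | sarc f s => rfl
  | larc f b =>
    by_cases hy : ∃ i, (i, b) ∈ y.larcs
    · obtain ⟨i, hi⟩ := hy
      have hex : (∃ j, (j, b) ∈ (concat x y).larcs) ↔ ∃ j, (j, i) ∈ x.larcs := by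
        refine exists_congr fun j => mem_concat.trans ⟨?_, fun hj => ⟨i, hj, hi⟩⟩
        rintro ⟨l, hj, hl⟩
        exact y.larc_eq_right hl hi ▸ hj
      rw [subst_larc_of_mem hi]
      by_cases hx : ∃ j, (j, i) ∈ x.larcs
      · obtain ⟨j, hj⟩ := hx
        rw [subst_larc_of_mem hj, subst_larc_of_mem (mem_concat.2 ⟨i, hj, hi⟩)]
      · rw [subst_larc_of_notMem hx, subst_larc_of_notMem (mt hex.1 hx)]
    · rw [subst_larc_of_notMem hy, subst_larc_of_notMem, subst_sarc]
      rintro ⟨j, hj⟩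
      obtain ⟨l, -, hl⟩ := mem_concat.1 hj
      exact hy ⟨l, hl⟩

end SlarcLetter

open SlarcLetter

/-- A diagram with flags, given by its letters from bottom to top along the right line. -/
abbrev SlarcWord : Type := List SlarcLetter

namespace SlarcWord

/-- The homological degree of a word. -/
def degree (w : SlarcWord) : ℕ := (w.map SlarcLetter.degree).sum

/-- The number of distinguished letters of a word. -/
def numDist (w : SlarcWord) : ℕ := (w.map SlarcLetter.numDist).sum

/-- The number of right points of the underlying diagram of a word. -/
def numRight (w : SlarcWord) : ℕ := (w.map SlarcLetter.numRight).sum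

/-- The number of long arcs of a word. -/
def numLarcs (w : SlarcWord) : ℕ := (w.map SlarcLetter.numLarcs).sum

/-- The left ends of the long arcs of a word. -/
def larcEnds (w : SlarcWord) : Set ℕ := {b | ∃ f, larc f b ∈ w}

/-- The left ends of the long arcs are increasing, at least `a` and less than `m`. -/
def Valid (m : ℕ) : ℕ → SlarcWord → Prop
  | a, [] => a ≤ m
  | a, larc _ b :: w => a ≤ b ∧ Valid m (b + 1) w
  | a, sarc _ _ :: w => Valid m a w

/-- The long arcs of a word whose right points are numbered starting with `c`. -/
def larcsFrom : ℕ → SlarcWord → Finset (ℕ × ℕ)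
  | _, [] => ∅
  | c, larc _ b :: w => insert (b, c) (larcsFrom (c + 1) w)
  | c, sarc _ false :: w => larcsFrom (c + 1) w
  | c, sarc _ true :: w => larcsFrom c w

/-- The generator of a word: its unmarked letters become long arcs with left ends `c`, `c + 1`,
and so on. -/
def genFrom : ℕ → SlarcWord → SlarcWord
  | _, [] => []
  | c, larc f _ :: w => larc f c :: genFrom (c + 1) w
  | c, sarc f false :: w => larc f c :: genFrom (c + 1) w
  | c, sarc f true :: w => sarc f true :: genFrom c w

variable {m a c : ℕ} {w : SlarcWord}

@[simp] lemma larcEnds_larc_cons (f : Bool) (b : ℕ) (w : SlarcWord) :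
    larcEnds (larc f b :: w) = insert b (larcEnds w) := by
  ext l
  simp only [larcEnds, Set.mem_ofPred_eq, Set.mem_insert_iff, List.mem_cons, larc.injEq, exists_or,
    exists_eq_left]

@[simp] lemma larcEnds_sarc_cons (f s : Bool) (w : SlarcWord) :
    larcEnds (sarc f s :: w) = larcEnds w := by
  simp only [larcEnds, List.mem_cons, reduceCtorEq, false_or]

lemma Valid.mono {a' : ℕ} (h : Valid m a w) (ha : a' ≤ a) : Valid m a' w := by
  induction w with
  | nil => exact ha.trans h
  | cons l w ih =>
    cases l with
    | larc f b => exact ⟨ha.trans h.1, h.2⟩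
    | sarc f s => exact ih h

lemma Valid.le (h : Valid m a w) : a ≤ m := by
  induction w generalizing a with
  | nil => exact h
  | cons l w ih =>
    cases l with
    | larc f b => exact h.1.trans (Nat.le_of_succ_le (ih h.2))
    | sarc f s => exact ih h

lemma Valid.le_of_mem_larcEnds {b : ℕ} (h : Valid m a w) (hb : b ∈ larcEnds w) : a ≤ b := by
  induction w generalizing a with
  | nil => simp [larcEnds] at hb
  | cons l w ih =>
    cases l with
    | larc f b' =>
      rw [larcEnds_larc_cons] at hb
      rcases hb with rfl | hb
      · exact h.1
      · exact h.1.trans (Nat.le_of_succ_le (ih h.2 hb))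
    | sarc f s => exact ih h (larcEnds_sarc_cons f s w ▸ hb)

lemma bounds_of_mem_larcsFrom {i j : ℕ} (h : Valid m a w) (hij : (i, j) ∈ larcsFrom c w) :
    a ≤ i ∧ i < m ∧ c ≤ j ∧ j < c + numRight w := by
  simp only [numRight]
  induction w generalizing a c with
  | nil => simp [larcsFrom] at hij
  | cons l w ih =>
    rw [List.map_cons, List.sum_cons]
    match l with
    | larc f b =>
      obtain ⟨hab, hw⟩ := h
      simp only [larcsFrom, Finset.mem_insert, Prod.mk.injEq] at hij
      simp only [SlarcLetter.numRight]
      rcases hij with ⟨rfl, rfl⟩ | hij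
      · have := hw.le
        omega
      · have := ih hw hij
        omega
    | sarc f false =>
      have := ih h hij
      simp only [SlarcLetter.numRight, cond_false]
      omega
    | sarc f true =>
      have := ih h hij
      simp only [SlarcLetter.numRight, cond_true]
      omega

lemma planar_larcsFrom (h : Valid m a w) {i j i' j' : ℕ}
    (hij : (i, j) ∈ larcsFrom c w) (hij' : (i', j') ∈ larcsFrom c w) : i < i' ↔ j < j' := by
  induction w generalizing a c with
  | nil => simp [larcsFrom] at hij
  | cons l w ih =>
    match l with
    | larc f b =>
      simp only [larcsFrom, Finset.mem_insert, Prod.mk.injEq] at hij hij'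
      rcases hij with ⟨rfl, rfl⟩ | hij <;> rcases hij' with ⟨rfl, rfl⟩ | hij'
      · simp only [lt_irrefl]
      · have := bounds_of_mem_larcsFrom h.2 hij'
        omega
      · have := bounds_of_mem_larcsFrom h.2 hij
        omega
      · exact ih h.2 hij hij'
    | sarc _ false => exact ih (c := c + 1) h hij hij'
    | sarc _ true => exact ih (c := c) h hij hij'

lemma card_larcsFrom (h : Valid m a w) : (larcsFrom c w).card = numLarcs w := by
  simp only [numLarcs]
  induction w generalizing a c with
  | nil => rfl
  | cons l w ih =>
    rw [List.map_cons, List.sum_cons]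
    match l with
    | larc f b =>
      rw [larcsFrom, Finset.card_insert_of_notMem, ih h.2, SlarcLetter.numLarcs, add_comm]
      intro hmem
      have := bounds_of_mem_larcsFrom h.2 hmem
      omega
    | sarc _ false => exact (ih h).trans (zero_add _).symm
    | sarc _ true => exact (ih h).trans (zero_add _).symm

lemma exists_mem_larcsFrom {i : ℕ} : (∃ j, (i, j) ∈ larcsFrom c w) ↔ i ∈ larcEnds w := by
  induction w generalizing c with
  | nil => simp [larcsFrom, larcEnds]
  | cons l w ih =>
    match l with
    | larc f b =>
      simp only [larcsFrom, Finset.mem_insert, Prod.mk.injEq, exists_or, ih, larcEnds_larc_cons,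
        Set.mem_insert_iff, exists_and_left, exists_eq, and_true]
    | sarc f false => rw [larcsFrom, ih, larcEnds_sarc_cons]
    | sarc f true => rw [larcsFrom, ih, larcEnds_sarc_cons]

/-- The underlying diagram of a word, obtained by forgetting the marked short arcs and the
distinction. -/
def toDiagram (m : ℕ) (w : SlarcWord) (h : Valid m 0 w) : SlarcDiagram where
  left := m
  right := numRight w
  larcs := larcsFrom 0 w
  left_lt := fun _ hp => (bounds_of_mem_larcsFrom h hp).2.1
  right_lt := fun _ hp => (bounds_of_mem_larcsFrom h hp).2.2.2.trans_eq (zero_add _)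
  planar := fun _ hp _ hq => planar_larcsFrom h hp hq

lemma numSarcs_toDiagram_add (h : Valid m 0 w) :
    (toDiagram m w h).numSarcs + 2 * numLarcs w = m + numRight w := by
  rw [← card_larcsFrom (c := 0) h]
  exact numSarcs_add_two_mul_card_larcs (toDiagram m w h)

lemma composable_toDiagram (h : Valid m 0 w) {x : SlarcDiagram} :
    Composable x (toDiagram m w h) ↔ x.right = m ∧ (x.rightSarcs : Set ℕ) ⊆ larcEnds w := by
  refine and_congr_right fun hm => ?_
  rw [leftSarcs_eq_sdiff, Finset.disjoint_left, Set.subset_def]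
  refine forall₂_congr fun l hl => ?_
  have hl_range : l ∈ Finset.range (toDiagram m w h).left :=
    (congrArg Finset.range hm) ▸ (Finset.mem_filter.1 hl).1
  rw [Finset.mem_sdiff, and_iff_right hl_range, not_not, mem_leftEnds]
  exact exists_mem_larcsFrom

lemma map_map_subst {α : Type*} {φ : SlarcLetter → α}
    (hφ : ∀ f a, φ (larc f a) = φ (sarc f false)) (x : SlarcDiagram) (w : SlarcWord) :
    (w.map (subst x)).map φ = w.map φ := by
  rw [List.map_map]
  exact List.map_congr_left fun l _ => apply_subst hφ x l

lemma map_genFrom {α : Type*} {φ : SlarcLetter → α}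
    (hφ : ∀ f a, φ (larc f a) = φ (sarc f false)) (c : ℕ) (w : SlarcWord) :
    (genFrom c w).map φ = w.map φ := by
  induction w generalizing c with
  | nil => rfl
  | cons l w ih =>
    match l with
    | larc f b => rw [genFrom, List.map_cons, List.map_cons, ih, hφ, hφ]
    | sarc f false => rw [genFrom, List.map_cons, List.map_cons, ih, hφ]
    | sarc f true => rw [genFrom, List.map_cons, List.map_cons, ih]

lemma degree_map_subst (x : SlarcDiagram) (w : SlarcWord) :
    degree (w.map (subst x)) = degree w :=
  congrArg List.sum (map_map_subst (fun _ _ => rfl) x w)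

lemma numDist_map_subst (x : SlarcDiagram) (w : SlarcWord) :
    numDist (w.map (subst x)) = numDist w :=
  congrArg List.sum (map_map_subst (fun _ _ => rfl) x w)

lemma numRight_map_subst (x : SlarcDiagram) (w : SlarcWord) :
    numRight (w.map (subst x)) = numRight w :=
  congrArg List.sum (map_map_subst (fun _ _ => rfl) x w)

lemma degree_genFrom (c : ℕ) (w : SlarcWord) : degree (genFrom c w) = degree w :=
  congrArg List.sum (map_genFrom (fun _ _ => rfl) c w)

lemma numDist_genFrom (c : ℕ) (w : SlarcWord) : numDist (genFrom c w) = numDist w :=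
  congrArg List.sum (map_genFrom (fun _ _ => rfl) c w)

lemma numRight_genFrom (c : ℕ) (w : SlarcWord) : numRight (genFrom c w) = numRight w :=
  congrArg List.sum (map_genFrom (fun _ _ => rfl) c w)

lemma numLarcs_genFrom (c : ℕ) (w : SlarcWord) : numLarcs (genFrom c w) = numRight w := by
  simp only [numLarcs, numRight]
  induction w generalizing c with
  | nil => rfl
  | cons l w ih =>
    match l with
    | larc f b => rw [genFrom, List.map_cons, List.sum_cons, ih]; rfl
    | sarc f false => rw [genFrom, List.map_cons, List.sum_cons, ih]; rfl
    | sarc f true => rw [genFrom, List.map_cons, List.sum_cons, ih]; rfl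

lemma genFrom_map_subst (x : SlarcDiagram) (c : ℕ) (w : SlarcWord) :
    genFrom c (w.map (subst x)) = genFrom c w := by
  induction w generalizing c with
  | nil => rfl
  | cons l w ih =>
    match l with
    | larc f b =>
      by_cases h : ∃ i, (i, b) ∈ x.larcs
      · rw [List.map_cons, subst_larc_of_mem h.choose_spec, genFrom, genFrom, ih]
      · rw [List.map_cons, subst_larc_of_notMem h, genFrom, genFrom, ih]
    | sarc f false => rw [List.map_cons, subst_sarc, genFrom, genFrom, ih]
    | sarc f true => rw [List.map_cons, subst_sarc, genFrom, genFrom, ih]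

lemma Valid.map_subst {a' : ℕ} (h : Valid m a w) (x : SlarcDiagram)
    (hx : ∀ i b, (i, b) ∈ x.larcs → a ≤ b → a' ≤ i) (ha' : a' ≤ x.left) :
    Valid x.left a' (w.map (subst x)) := by
  induction w generalizing a a' with
  | nil => exact ha'
  | cons l w ih =>
    cases l with
    | larc f b =>
      by_cases hb : ∃ i, (i, b) ∈ x.larcs
      · obtain ⟨i, hi⟩ := hb
        rw [List.map_cons, subst_larc_of_mem hi]
        refine ⟨hx i b hi h.1, ih h.2 (fun i' b' hi' hb' => ?_) (x.left_lt _ hi)⟩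
        exact (x.planar _ hi _ hi').2 hb'
      · rw [List.map_cons, subst_larc_of_notMem hb]
        exact ih h.2 (fun i' b' hi' hb' => hx i' b' hi' (h.1.trans (Nat.le_of_succ_le hb'))) ha'
    | sarc f s => exact ih h hx ha'

lemma mem_larcsFrom_map_subst {x : SlarcDiagram} {i j : ℕ} :
    (i, j) ∈ larcsFrom c (w.map (subst x)) ↔ ∃ l, (i, l) ∈ x.larcs ∧ (l, j) ∈ larcsFrom c w := by
  induction w generalizing c with
  | nil => simp [larcsFrom]
  | cons l w ih =>
    match l with
    | larc f b =>
      have hsplit : (∃ l, (i, l) ∈ x.larcs ∧ (l, j) ∈ larcsFrom c (larc f b :: w)) ↔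
          ((i, b) ∈ x.larcs ∧ j = c) ∨ ∃ l, (i, l) ∈ x.larcs ∧ (l, j) ∈ larcsFrom (c + 1) w := by
        simp only [larcsFrom, Finset.mem_insert, Prod.mk.injEq, and_or_left, exists_or,
          and_left_comm, exists_eq_left]
      rw [hsplit, List.map_cons, ← ih]
      by_cases hb : ∃ i, (i, b) ∈ x.larcs
      · obtain ⟨i', hi'⟩ := hb
        have hi : (i, b) ∈ x.larcs ↔ i = i' :=
          ⟨fun h => x.larc_eq_right h hi', fun h => h ▸ hi'⟩
        rw [subst_larc_of_mem hi', larcsFrom, Finset.mem_insert, Prod.mk.injEq, hi]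
      · rw [subst_larc_of_notMem hb, larcsFrom, or_iff_right fun h => hb ⟨i, h.1⟩]
    | sarc _ false => exact ih
    | sarc _ true => exact ih

lemma valid_genFrom (h : c + numRight w ≤ m) : Valid m c (genFrom c w) := by
  simp only [numRight] at h
  induction w generalizing c with
  | nil => exact h
  | cons l w ih =>
    rw [List.map_cons, List.sum_cons] at h
    match l with
    | larc _ _ => exact ⟨le_rfl, ih (by rwa [add_assoc])⟩
    | sarc _ false => exact ⟨le_rfl, ih (by rwa [add_assoc])⟩
    | sarc _ true => exact ih (c := c) (by simpa [SlarcLetter.numRight] using h)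

lemma map_subst_genFrom (h : Valid m a w) (y : SlarcDiagram)
    (hy : ∀ i j, c ≤ j → ((i, j) ∈ y.larcs ↔ (i, j) ∈ larcsFrom c w)) :
    (genFrom c w).map (subst y) = w := by
  induction w generalizing a c with
  | nil => rfl
  | cons l w ih =>
    match l with
    | larc f b =>
      have hbc : (b, c) ∈ y.larcs := (hy b c le_rfl).2 (Finset.mem_insert_self _ _)
      rw [genFrom, List.map_cons, ih h.2, subst_larc_of_mem hbc]
      intro i j hj
      rw [hy i j (Nat.le_of_succ_le hj), larcsFrom, Finset.mem_insert, or_iff_right]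
      rintro ⟨⟩
      exact absurd hj (Nat.not_succ_le_self c)
    | sarc f false =>
      rw [genFrom, List.map_cons, ih (a := a) h fun i j hj => hy i j (Nat.le_of_succ_le hj),
        subst_larc_of_notMem]
      rintro ⟨i, hi⟩
      have := bounds_of_mem_larcsFrom (a := a) (w := w) h ((hy i c le_rfl).1 hi)
      omega
    | sarc f true => rw [genFrom, List.map_cons, ih (a := a) h hy, subst_sarc]

/-- The words over `m` left points of homological degree `i` with `n` distinguished letters. -/
def ofDegree (n i m : ℕ) : Set SlarcWord := {w | Valid m 0 w ∧ degree w = i ∧ numDist w = n}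

lemma map_subst_mem_ofDegree {n i : ℕ} (hw : w ∈ ofDegree n i m) (x : SlarcDiagram) :
    w.map (subst x) ∈ ofDegree n i x.left :=
  ⟨hw.1.map_subst x (fun _ _ _ _ => Nat.zero_le _) (Nat.zero_le _),
    (degree_map_subst x w).trans hw.2.1, (numDist_map_subst x w).trans hw.2.2⟩

end SlarcWord

open SlarcWord

/-- The basis of the term of homological degree `i` of the resolution of the simple module `L_n`:
words over any number of left points. -/
@[ext]
structure MarkedDiagram (n i : ℕ) where
  left : ℕ
  word : SlarcWord
  mem : word ∈ ofDegree n i left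

namespace MarkedDiagram

variable {n i : ℕ}

lemma valid (p : MarkedDiagram n i) : Valid p.left 0 p.word := p.mem.1

noncomputable instance : DiagramSet (MarkedDiagram n i) where
  diagram p := toDiagram p.left p.word p.valid
  act x p := ⟨x.left, p.word.map (subst x), map_subst_mem_ofDegree p.mem x⟩
  gen p := ⟨numRight p.word, genFrom 0 p.word, valid_genFrom (zero_add _).le,
    (degree_genFrom _ _).trans p.mem.2.1, (numDist_genFrom _ _).trans p.mem.2.2⟩
  diagram_act := by
    intro x p _
    ext1
    · rfl
    · exact numRight_map_subst x p.word
    · ext ⟨i, j⟩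
      rw [mem_concat]
      exact mem_larcsFrom_map_subst
  act_act := by
    intro x y p _
    refine MarkedDiagram.ext rfl (List.map_map.trans ?_)
    exact List.map_congr_left fun l _ => subst_subst x y l
  gen_act := by
    intro x p _
    exact MarkedDiagram.ext (numRight_map_subst x p.word) (genFrom_map_subst x 0 p.word)
  diagram_gen := by
    intro p
    have hvalid : Valid (numRight p.word) 0 (genFrom 0 p.word) := valid_genFrom (zero_add _).le
    have hcard : (larcsFrom 0 (genFrom 0 p.word)).card = numRight p.word :=
      (card_larcsFrom hvalid).trans (numLarcs_genFrom 0 p.word)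
    refine (eq_one_of_card_larcs (x := toDiagram _ _ hvalid) hcard ?_).trans (congrArg one hcard)
    exact hcard.trans (numRight_genFrom 0 p.word).symm
  act_gen p := MarkedDiagram.ext rfl (map_subst_genFrom p.valid _ fun _ _ _ => Iff.rfl)

end MarkedDiagram

/-! ### The differential of a word and its contraction -/

namespace SlarcWord

/-- `Step w w'` means that `w'` is obtained from `w` by deleting a long arc that is not
distinguished or by unmarking a marked short arc. -/
inductive Step : SlarcWord → SlarcWord → Prop
  | erase (a : ℕ) (w : SlarcWord) : Step (larc false a :: w) w
  | unmark (f : Bool) (w : SlarcWord) : Step (sarc f true :: w) (sarc f false :: w)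
  | cons (l : SlarcLetter) {w w' : SlarcWord} (h : Step w w') : Step (l :: w) (l :: w')

/-- The word has no short arcs. -/
def NoSarcs : SlarcWord → Prop
  | [] => True
  | larc _ _ :: w => NoSarcs w
  | sarc _ _ :: _ => False

/-- The word `larc true a, larc true (a + 1), …` of length `d`. -/
def fullWord (a d : ℕ) : SlarcWord := (List.range' a d).map (larc true)

lemma fullWord_succ (a d : ℕ) : fullWord a (d + 1) = larc true a :: fullWord (a + 1) d := rfl

namespace Step

variable {w w' : SlarcWord}

lemma degree_eq (h : Step w w') : degree w = degree w' + 1 := by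
  simp only [degree]
  induction h with
  | erase _ w => exact add_comm _ _
  | unmark f w =>
    simp only [List.map_cons, List.sum_cons, SlarcLetter.degree, cond_true, cond_false]
    omega
  | cons l _ ih => rw [List.map_cons, List.sum_cons, ih, List.map_cons, List.sum_cons, add_assoc]

lemma numDist_eq (h : Step w w') : numDist w = numDist w' := by
  simp only [numDist]
  induction h with
  | erase _ w => exact zero_add _
  | unmark f w => rfl
  | cons l _ ih => rw [List.map_cons, List.sum_cons, ih, List.map_cons, List.sum_cons]

lemma numRight_add_two_mul_numLarcs (h : Step w w') :
    numRight w' + 2 * numLarcs w = numRight w + 2 * numLarcs w' + 1 := by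
  simp only [numRight, numLarcs]
  induction h with
  | erase a w =>
    simp only [List.map_cons, List.sum_cons, SlarcLetter.numRight, SlarcLetter.numLarcs]
    omega
  | unmark f w =>
    simp only [List.map_cons, List.sum_cons, SlarcLetter.numRight, SlarcLetter.numLarcs,
      cond_true, cond_false]
    omega
  | cons l _ ih =>
    simp only [List.map_cons, List.sum_cons]
    omega

lemma noSarcs_iff (h : Step w w') : NoSarcs w ↔ NoSarcs w' := by
  induction h with
  | erase a w => rfl
  | unmark f w => rfl
  | cons l _ ih =>
    cases l with
    | larc f b => exact ih
    | sarc f s => rfl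

lemma valid {m a : ℕ} (h : Step w w') (hw : Valid m a w) : Valid m a w' := by
  induction h generalizing a with
  | erase b w => exact hw.2.mono (Nat.le_succ_of_le hw.1)
  | unmark f w => exact hw
  | cons l _ ih =>
    cases l with
    | larc f b => exact ⟨hw.1, ih hw.2⟩
    | sarc f s => exact ih (a := a) hw

lemma mem_ofDegree {n i m : ℕ} (h : Step w w') (hw : w ∈ ofDegree n (i + 1) m) :
    w' ∈ ofDegree n i m :=
  ⟨h.valid hw.1, Nat.succ_injective (h.degree_eq.symm.trans hw.2.1),
    h.numDist_eq.symm.trans hw.2.2⟩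

lemma mem_ofDegree_succ {n i m : ℕ} (h : Step w w') (hw : Valid m 0 w)
    (hw' : w' ∈ ofDegree n i m) : w ∈ ofDegree n (i + 1) m :=
  ⟨hw, h.degree_eq.trans (congrArg Nat.succ hw'.2.1), h.numDist_eq.trans hw'.2.2⟩

lemma numSarcs_toDiagram {m : ℕ} (h : Step w w') (hw : Valid m 0 w) (hw' : Valid m 0 w') :
    (toDiagram m w' hw').numSarcs = (toDiagram m w hw).numSarcs + 1 := by
  have hsarcs := numSarcs_toDiagram_add hw
  have hsarcs' := numSarcs_toDiagram_add hw'
  have hstep := h.numRight_add_two_mul_numLarcs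
  omega

end Step

/-- The vector space spanned by the words. -/
abbrev Span (k : Type u) [Field k] : Type u := SlarcWord →₀ k

noncomputable section

variable (k : Type u) [Field k]

/-- Prefixing words with a letter. -/
def consLin (l : SlarcLetter) : Span k →ₗ[k] Span k := Finsupp.lmapDomain k k (List.cons l)

/-- The sign of a letter. -/
def sign (l : SlarcLetter) : k := (-1) ^ l.degree

/-- The terms of the differential of `l :: w` that come from the letter `l`. -/
def diffHead : SlarcLetter → Span k →ₗ[k] Span k
  | larc true _ => 0
  | larc false _ => LinearMap.id
  | sarc _ false => 0
  | sarc f true => consLin k (sarc f false)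

/-- The differential of a word: the signed derivation that maps the letters `larc false a` to the
empty word and `sarc f true` to `sarc f false`. -/
def diffWord : SlarcWord → Span k
  | [] => 0
  | l :: w => diffHead k l (Finsupp.single w 1) + sign k l • consLin k l (diffWord w)

/-- The linear extension of `diffWord`. -/
def diff : Span k →ₗ[k] Span k := Finsupp.linearCombination k (diffWord k)

@[simp] lemma consLin_single (l : SlarcLetter) (w : SlarcWord) (c : k) :
    consLin k l (Finsupp.single w c) = Finsupp.single (l :: w) c :=
  Finsupp.mapDomain_single

variable {k} in
lemma consLin_mem_supported {l : SlarcLetter} {s t : Set SlarcWord} (h : ∀ w ∈ s, l :: w ∈ t)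
    {q : Span k} (hq : q ∈ Finsupp.supported k k s) :
    consLin k l q ∈ Finsupp.supported k k t := by
  refine apply_mem_of_mem_supported (fun w hw => ?_) hq
  rw [consLin_single]
  exact Finsupp.single_mem_supported k 1 (h w hw)

@[simp] lemma diff_single (w : SlarcWord) : diff k (Finsupp.single w 1) = diffWord k w := by
  rw [diff, Finsupp.linearCombination_single, one_smul]

lemma diff_consLin (l : SlarcLetter) (q : Span k) :
    diff k (consLin k l q) = diffHead k l q + sign k l • consLin k l (diff k q) := by
  refine apply_eq_of_apply_single_eq (f := diff k ∘ₗ consLin k l)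
    (g := diffHead k l + sign k l • consLin k l ∘ₗ diff k) (fun w => ?_) q
  simp [diffWord]

lemma diff_diffHead_add (l : SlarcLetter) (q : Span k) :
    diff k (diffHead k l q) + sign k l • diffHead k l (diff k q) = 0 := by
  match l with
  | larc true _ => simp [diffHead]
  | larc false _ => simp [diffHead, sign, SlarcLetter.degree]
  | sarc _ false => simp [diffHead]
  | sarc f true => simp [diffHead, diff_consLin, sign, SlarcLetter.degree, pow_succ]

lemma diff_diffWord (w : SlarcWord) : diff k (diffWord k w) = 0 := by
  induction w with
  | nil => exact map_zero _
  | cons l w ih =>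
    rw [diffWord, map_add, map_smul, diff_consLin, ih, map_zero, smul_zero, add_zero, ← diff_single,
      diff_diffHead_add]

lemma diffWord_mem_supported (w : SlarcWord) :
    diffWord k w ∈ Finsupp.supported k k {w' | Step w w'} := by
  induction w with
  | nil => exact Submodule.zero_mem _
  | cons l w ih =>
    have htail := consLin_mem_supported (t := {w' | Step (l :: w) w'})
      (fun w' hw' => Step.cons l hw') ih
    refine Submodule.add_mem _ ?_ (Submodule.smul_mem _ _ htail)
    match l with
    | larc true _ => exact Submodule.zero_mem _
    | larc false a => exact Finsupp.single_mem_supported k 1 (Step.erase a w)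
    | sarc _ false => exact Submodule.zero_mem _
    | sarc f true =>
      rw [diffHead, consLin_single]
      exact Finsupp.single_mem_supported k 1 (Step.unmark f w)

lemma diffWord_mem_supported_ofDegree {n i m : ℕ} {w : SlarcWord} (hw : w ∈ ofDegree n (i + 1) m) :
    diffWord k w ∈ Finsupp.supported k k (ofDegree n i m) :=
  Finsupp.supported_mono (fun _ h => Step.mem_ofDegree h hw) (diffWord_mem_supported k w)

lemma diffWord_eq_zero {w : SlarcWord} (hw : degree w = 0) : diffWord k w = 0 := by
  have hempty : {w' | Step w w'} = ∅ := Set.eq_empty_of_forall_notMem fun w' h =>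
    Nat.succ_ne_zero _ ((Step.degree_eq h).symm.trans hw)
  have hmem := diffWord_mem_supported k w
  rwa [hempty, Finsupp.supported_empty, Submodule.mem_bot] at hmem

/-- The part of the contracting homotopy that deals with words with short arcs: it marks the first
short arc. -/
def markWord : SlarcWord → Span k
  | [] => 0
  | larc f b :: w => sign k (larc f b) • consLin k (larc f b) (markWord w)
  | sarc f false :: w => Finsupp.single (sarc f true :: w) 1
  | sarc _ true :: _ => 0

/-- The linear extension of `markWord`. -/
def markLin : Span k →ₗ[k] Span k := Finsupp.linearCombination k (markWord k)

@[simp] lemma markLin_single (w : SlarcWord) : markLin k (Finsupp.single w 1) = markWord k w := by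
  rw [markLin, Finsupp.linearCombination_single, one_smul]

lemma markLin_consLin_larc (f : Bool) (b : ℕ) (q : Span k) :
    markLin k (consLin k (larc f b) q) =
      sign k (larc f b) • consLin k (larc f b) (markLin k q) := by
  refine apply_eq_of_apply_single_eq (f := markLin k ∘ₗ consLin k (larc f b))
    (g := sign k (larc f b) • consLin k (larc f b) ∘ₗ markLin k) (fun w => ?_) q
  simp [markWord]

lemma markLin_consLin_sarc_false (f : Bool) (q : Span k) :
    markLin k (consLin k (sarc f false) q) = consLin k (sarc f true) q := by
  refine apply_eq_of_apply_single_eq (f := markLin k ∘ₗ consLin k (sarc f false))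
    (fun w => ?_) q
  simp [markWord]

lemma markLin_consLin_sarc_true (f : Bool) (q : Span k) :
    markLin k (consLin k (sarc f true) q) = 0 := by
  refine apply_eq_of_apply_single_eq (f := markLin k ∘ₗ consLin k (sarc f true)) (g := 0)
    (fun w => ?_) q
  simp [markWord]

lemma diff_markWord_add {w : SlarcWord} (h : ¬ NoSarcs w) :
    diff k (markWord k w) + markLin k (diffWord k w) = Finsupp.single w 1 := by
  induction w with
  | nil => exact absurd trivial h
  | cons l w ih =>
    match l with
    | larc f b =>
      rw [← consLin_single, ← ih h]
      cases f <;> simp [markWord, diffWord, diff_consLin, markLin_consLin_larc, diffHead, sign,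
        SlarcLetter.degree]
    | sarc f false =>
      rw [markWord, ← consLin_single, diff_consLin]
      cases f <;> simp [diffWord, markLin_consLin_sarc_false, diffHead, sign, SlarcLetter.degree]
    | sarc f true => simp [markWord, diffWord, markLin_consLin_sarc_true, diffHead]

lemma markWord_mem_supported {m a : ℕ} {w : SlarcWord} (h : Valid m a w) :
    markWord k w ∈ Finsupp.supported k k {w' | Step w' w ∧ Valid m a w'} := by
  induction w generalizing a with
  | nil => exact Submodule.zero_mem _
  | cons l w ih =>
    match l with
    | larc f b =>
      refine Submodule.smul_mem _ _ (consLin_mem_supported (fun w' hw' => ?_) (ih h.2))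
      exact ⟨.cons _ hw'.1, h.1, hw'.2⟩
    | sarc f false => exact Finsupp.single_mem_supported k 1 ⟨Step.unmark f w, h⟩
    | sarc _ true => exact Submodule.zero_mem _

/-- The part of the contracting homotopy that deals with words without short arcs: it inserts the
first left point in the range from `a` to `m` that is not the end of a distinguished long arc, if
it is not the end of any long arc. -/
def insertWord (m : ℕ) : ℕ → SlarcWord → Span k
  | a, [] => if a < m then Finsupp.single [larc false a] 1 else 0
  | a, larc f b :: w =>
    if b = a then cond f (consLin k (larc f b) (insertWord m (a + 1) w)) 0
    else Finsupp.single (larc false a :: larc f b :: w) 1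
  | _, sarc _ _ :: _ => 0

/-- The linear extension of `insertWord`. -/
def insertLin (m a : ℕ) : Span k →ₗ[k] Span k := Finsupp.linearCombination k (insertWord k m a)

@[simp] lemma insertLin_single (m a : ℕ) (w : SlarcWord) :
    insertLin k m a (Finsupp.single w 1) = insertWord k m a w := by
  rw [insertLin, Finsupp.linearCombination_single, one_smul]

lemma insertLin_consLin_true (m a : ℕ) (q : Span k) :
    insertLin k m a (consLin k (larc true a) q) =
      consLin k (larc true a) (insertLin k m (a + 1) q) := by
  refine apply_eq_of_apply_single_eq (f := insertLin k m a ∘ₗ consLin k (larc true a))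
    (g := consLin k (larc true a) ∘ₗ insertLin k m (a + 1)) (fun w => ?_) q
  simp [insertWord]

lemma insertLin_consLin_false (m a : ℕ) (q : Span k) :
    insertLin k m a (consLin k (larc false a) q) = 0 := by
  refine apply_eq_of_apply_single_eq (f := insertLin k m a ∘ₗ consLin k (larc false a)) (g := 0)
    (fun w => ?_) q
  simp [insertWord]

section

variable {m a : ℕ} {w : SlarcWord}

lemma insertWord_of_valid_succ (h : Valid m (a + 1) w) (hs : NoSarcs w) :
    insertWord k m a w = Finsupp.single (larc false a :: w) 1 := by
  match w with
  | [] => exact if_pos h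
  | larc _ _ :: _ => exact if_neg (Nat.lt_of_succ_le h.1).ne'
  | sarc _ _ :: _ => exact hs.elim

lemma insertLin_diffWord_of_valid_succ (h : Valid m (a + 1) w) (hs : NoSarcs w) :
    insertLin k m a (diffWord k w) = consLin k (larc false a) (diffWord k w) := by
  refine apply_eq_of_mem_supported (fun w' hw' => ?_) (diffWord_mem_supported k w)
  rw [insertLin_single, consLin_single,
    insertWord_of_valid_succ k (Step.valid hw' h) ((Step.noSarcs_iff hw').1 hs)]

lemma diff_insertWord_add_of_valid_succ (h : Valid m (a + 1) w) (hs : NoSarcs w) :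
    diff k (insertWord k m a w) + insertLin k m a (diffWord k w) = Finsupp.single w 1 := by
  rw [insertWord_of_valid_succ k h hs, insertLin_diffWord_of_valid_succ k h hs, ← consLin_single,
    diff_consLin]
  simp [diffHead, sign, SlarcLetter.degree]

lemma diff_insertWord_add_larc_false (h : Valid m (a + 1) w) (hs : NoSarcs w) :
    diff k (insertWord k m a (larc false a :: w)) +
        insertLin k m a (diffWord k (larc false a :: w)) =
      Finsupp.single (larc false a :: w) 1 := by
  rw [← insertWord_of_valid_succ k h hs]
  simp [insertWord, diffWord, insertLin_consLin_false, diffHead]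

lemma diff_insertWord_add_larc_true :
    diff k (insertWord k m a (larc true a :: w)) + insertLin k m a (diffWord k (larc true a :: w)) =
      consLin k (larc true a)
        (diff k (insertWord k m (a + 1) w) + insertLin k m (a + 1) (diffWord k w)) := by
  simp [insertWord, diffWord, diff_consLin, insertLin_consLin_true, diffHead, sign,
    SlarcLetter.degree]

lemma diff_insertWord_add (h : Valid m a w) (hs : NoSarcs w) (hw : w ≠ fullWord a (m - a)) :
    diff k (insertWord k m a w) + insertLin k m a (diffWord k w) = Finsupp.single w 1 := by
  induction w generalizing a with
  | nil =>
    refine diff_insertWord_add_of_valid_succ k (lt_of_le_of_ne h fun ham => hw ?_) hs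
    rw [ham, Nat.sub_self]
    rfl
  | cons l w ih =>
    match l with
    | sarc _ _ => exact hs.elim
    | larc f b =>
      rcases h.1.eq_or_lt with rfl | hab
      · cases f with
        | false => exact diff_insertWord_add_larc_false k h.2 hs
        | true =>
          rw [diff_insertWord_add_larc_true, ih h.2 hs, consLin_single]
          rintro rfl
          have hma : m - a = m - (a + 1) + 1 := by
            have := h.2.le
            omega
          exact hw (by rw [hma, fullWord_succ])
      · exact diff_insertWord_add_of_valid_succ k ⟨hab, h.2⟩ hs

lemma insertWord_mem_supported (h : Valid m a w) :
    insertWord k m a w ∈ Finsupp.supported k k {w' | Step w' w ∧ Valid m a w'} := by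
  induction w generalizing a with
  | nil =>
    rw [insertWord]
    split_ifs with ha
    · exact Finsupp.single_mem_supported k 1 ⟨Step.erase a _, le_rfl, ha⟩
    · exact Submodule.zero_mem _
  | cons l w ih =>
    match l with
    | sarc _ _ => exact Submodule.zero_mem _
    | larc f b =>
      rw [insertWord]
      split_ifs with hba
      · subst hba
        cases f with
        | false => exact Submodule.zero_mem _
        | true =>
          refine consLin_mem_supported (fun w' hw' => ?_) (ih h.2)
          exact ⟨.cons _ hw'.1, h.1, hw'.2⟩
      · refine Finsupp.single_mem_supported k 1 ⟨Step.erase a _, le_rfl, ?_, h.2⟩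
        exact lt_of_le_of_ne h.1 (Ne.symm hba)

end

open Classical in
/-- The contracting homotopy on words over `m` left points. -/
def homotopyWord (m : ℕ) (w : SlarcWord) : Span k :=
  if NoSarcs w then insertWord k m 0 w else markWord k w

/-- The linear extension of `homotopyWord`. -/
def homotopy (m : ℕ) : Span k →ₗ[k] Span k := Finsupp.linearCombination k (homotopyWord k m)

@[simp] lemma homotopy_single (m : ℕ) (w : SlarcWord) :
    homotopy k m (Finsupp.single w 1) = homotopyWord k m w := by
  rw [homotopy, Finsupp.linearCombination_single, one_smul]

lemma diff_homotopyWord_add {m : ℕ} {w : SlarcWord} (h : Valid m 0 w) (hw : w ≠ fullWord 0 m) :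
    diff k (homotopyWord k m w) + homotopy k m (diffWord k w) = Finsupp.single w 1 := by
  by_cases hs : NoSarcs w
  · have hdiff : homotopy k m (diffWord k w) = insertLin k m 0 (diffWord k w) := by
      refine apply_eq_of_mem_supported (fun w' hw' => ?_) (diffWord_mem_supported k w)
      rw [homotopy_single, homotopyWord, if_pos ((Step.noSarcs_iff hw').1 hs), insertLin_single]
    rw [homotopyWord, if_pos hs, hdiff, diff_insertWord_add k h hs hw]
  · have hdiff : homotopy k m (diffWord k w) = markLin k (diffWord k w) := by
      refine apply_eq_of_mem_supported (fun w' hw' => ?_) (diffWord_mem_supported k w)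
      rw [homotopy_single, homotopyWord, if_neg (mt (Step.noSarcs_iff hw').2 hs), markLin_single]
    rw [homotopyWord, if_neg hs, hdiff, diff_markWord_add k hs]

lemma homotopyWord_mem_supported_ofDegree {n i m : ℕ} {w : SlarcWord} (hw : w ∈ ofDegree n i m) :
    homotopyWord k m w ∈ Finsupp.supported k k (ofDegree n (i + 1) m) := by
  have hmem : homotopyWord k m w ∈ Finsupp.supported k k {w' | Step w' w ∧ Valid m 0 w'} := by
    rw [homotopyWord]
    split_ifs
    · exact insertWord_mem_supported k hw.1
    · exact markWord_mem_supported k hw.1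
  exact Finsupp.supported_mono (fun w' hw' => Step.mem_ofDegree_succ hw'.1 hw'.2 hw) hmem

/-! ### The action of diagrams on words -/

open Classical in
/-- The action of a diagram on a word, which is `0` unless all left points in `T` are ends of long
arcs of the word. The action of `x` on diagrams is the case where `T` consists of the right points
of `x` at short arcs; the other cases occur in inductions, when letters of the word have been
removed. -/
def actWord (x : SlarcDiagram) (T : Set ℕ) (w : SlarcWord) : Span k :=
  if T ⊆ larcEnds w then Finsupp.single (w.map (subst x)) 1 else 0

/-- The linear extension of `actWord`. -/
def act (x : SlarcDiagram) (T : Set ℕ) : Span k →ₗ[k] Span k :=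
  Finsupp.linearCombination k (actWord k x T)

variable (x : SlarcDiagram) (T : Set ℕ)

@[simp] lemma act_single (w : SlarcWord) :
    act k x T (Finsupp.single w 1) = actWord k x T w := by
  rw [act, Finsupp.linearCombination_single, one_smul]

lemma actWord_larc_cons (f : Bool) (b : ℕ) (w : SlarcWord) :
    actWord k x T (larc f b :: w) = consLin k (subst x (larc f b)) (actWord k x (T \ {b}) w) := by
  rw [actWord, actWord]
  by_cases h : T \ {b} ⊆ larcEnds w
  · rw [if_pos h, if_pos (by rwa [larcEnds_larc_cons, ← Set.sdiff_singleton_subset_iff]),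
      consLin_single, List.map_cons]
  · rw [if_neg h, if_neg (by rwa [larcEnds_larc_cons, ← Set.sdiff_singleton_subset_iff]), map_zero]

lemma actWord_sarc_cons (f s : Bool) (w : SlarcWord) :
    actWord k x T (sarc f s :: w) = consLin k (sarc f s) (actWord k x T w) := by
  rw [actWord, actWord, larcEnds_sarc_cons]
  split_ifs
  · rw [consLin_single, List.map_cons, subst_sarc]
  · rw [map_zero]

lemma act_consLin_larc (f : Bool) (b : ℕ) (q : Span k) :
    act k x T (consLin k (larc f b) q) = consLin k (subst x (larc f b)) (act k x (T \ {b}) q) := by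
  refine apply_eq_of_apply_single_eq (f := act k x T ∘ₗ consLin k (larc f b))
    (g := consLin k (subst x (larc f b)) ∘ₗ act k x (T \ {b})) (fun w => ?_) q
  simp [actWord_larc_cons]

lemma act_consLin_sarc (f s : Bool) (q : Span k) :
    act k x T (consLin k (sarc f s) q) = consLin k (sarc f s) (act k x T q) := by
  refine apply_eq_of_apply_single_eq (f := act k x T ∘ₗ consLin k (sarc f s))
    (g := consLin k (sarc f s) ∘ₗ act k x T) (fun w => ?_) q
  simp [actWord_sarc_cons]

lemma sign_subst (l : SlarcLetter) : sign k (subst x l) = sign k l :=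
  apply_subst (φ := sign k) (fun _ _ => rfl) x l

variable {x T}

lemma actWord_eq_zero_of_valid_succ {m b : ℕ} {w : SlarcWord} (hw : Valid m (b + 1) w)
    (hb : b ∈ T) : actWord k x T w = 0 :=
  if_neg fun hT => Nat.not_succ_le_self b (hw.le_of_mem_larcEnds (hT hb))

lemma act_diffHead_larc {b : ℕ} {w : SlarcWord} (hw : Valid x.right (b + 1) w)
    (hb : b ∈ T ↔ ¬ ∃ i, (i, b) ∈ x.larcs) (f : Bool) :
    act k x T (diffHead k (larc f b) (Finsupp.single w 1)) =
      diffHead k (subst x (larc f b)) (actWord k x (T \ {b}) w) := by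
  by_cases hx : ∃ i, (i, b) ∈ x.larcs
  · obtain ⟨i, hi⟩ := hx
    rw [subst_larc_of_mem hi, Set.sdiff_singleton_eq_self fun hbT => hb.1 hbT ⟨i, hi⟩]
    cases f <;> simp [diffHead]
  · rw [subst_larc_of_notMem hx]
    cases f
    · simp [diffHead, actWord_eq_zero_of_valid_succ k hw (hb.2 hx)]
    · simp [diffHead]

lemma act_diffHead_sarc (f s : Bool) (w : SlarcWord) :
    act k x T (diffHead k (sarc f s) (Finsupp.single w 1)) =
      diffHead k (sarc f s) (actWord k x T w) := by
  cases s <;> simp [diffHead, actWord_sarc_cons]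

lemma act_diffWord {a : ℕ} {w : SlarcWord} (hw : Valid x.right a w)
    (hT : ∀ l, a ≤ l → l < x.right → (l ∈ T ↔ ¬ ∃ i, (i, l) ∈ x.larcs)) :
    act k x T (diffWord k w) = diff k (actWord k x T w) := by
  induction w generalizing a T with
  | nil =>
    rw [diffWord, map_zero, actWord]
    split_ifs <;> simp [diffWord]
  | cons l w ih =>
    rw [diffWord, map_add, map_smul]
    match l with
    | larc f b =>
      have hT' (l : ℕ) (hl : b + 1 ≤ l) (hlx : l < x.right) :
          l ∈ T \ {b} ↔ ¬ ∃ i, (i, l) ∈ x.larcs := by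
        rw [Set.mem_sdiff_singleton, and_iff_left (Nat.lt_of_succ_le hl).ne']
        exact hT l (hw.1.trans (Nat.le_of_succ_le hl)) hlx
      rw [actWord_larc_cons, diff_consLin, ← ih hw.2 hT', sign_subst, act_consLin_larc,
        act_diffHead_larc k hw.2 (hT b hw.1 hw.2.le)]
    | sarc f s =>
      rw [actWord_sarc_cons, diff_consLin, ← ih (a := a) hw hT, act_consLin_sarc, act_diffHead_sarc]

lemma actWord_mem_supported_ofDegree {n i m : ℕ} {w : SlarcWord} (hw : w ∈ ofDegree n i m) :
    actWord k x T w ∈ Finsupp.supported k k (ofDegree n i x.left) := by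
  rw [actWord]
  split_ifs
  · exact Finsupp.single_mem_supported k 1 (map_subst_mem_ofDegree hw x)
  · exact Submodule.zero_mem _

/-! ### Full words -/

lemma degree_fullWord (a d : ℕ) : degree (fullWord a d) = 0 := by
  simp [degree, fullWord, Function.comp_def, SlarcLetter.degree]

lemma numDist_fullWord (a d : ℕ) : numDist (fullWord a d) = d := by
  simp [numDist, fullWord, Function.comp_def, SlarcLetter.numDist]

lemma numRight_fullWord (a d : ℕ) : numRight (fullWord a d) = d := by
  simp [numRight, fullWord, Function.comp_def, SlarcLetter.numRight]

lemma genFrom_of_degree_eq_zero {w : SlarcWord} (hw : degree w = 0) (c : ℕ) :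
    genFrom c w = fullWord c (numRight w) := by
  simp only [degree, numRight] at hw ⊢
  induction w generalizing c with
  | nil => rfl
  | cons l w ih =>
    rw [List.map_cons, List.sum_cons, Nat.add_eq_zero_iff] at hw
    match l with
    | larc true _ =>
      rw [genFrom, ih hw.2, List.map_cons, List.sum_cons, SlarcLetter.numRight, add_comm 1,
        fullWord_succ]
    | larc false _ => exact absurd hw.1 one_ne_zero
    | sarc true false =>
      rw [genFrom, ih hw.2, List.map_cons, List.sum_cons, SlarcLetter.numRight, cond_false,
        add_comm 1, fullWord_succ]
    | sarc false false => exact absurd hw.1 one_ne_zero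
    | sarc true true => exact absurd hw.1 one_ne_zero
    | sarc false true => exact absurd hw.1 two_ne_zero

lemma valid_fullWord (a d : ℕ) : Valid (a + d) a (fullWord a d) := by
  have hgen := genFrom_of_degree_eq_zero (degree_fullWord a d) a
  rw [numRight_fullWord] at hgen
  rw [← hgen]
  exact valid_genFrom (by rw [numRight_fullWord])

end

end SlarcWord

/-! ### The resolution of the simple module `L_n` -/

namespace SlarcSimple

noncomputable section

variable {k : Type u} [Field k] {n : ℕ}

lemma unitalDiag_one_smul (s : SlarcSimple k n) : unitalDiag k (one n) • s = s := by
  classical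
  rw [smul_def, ← Unitization.lift_symm_apply_apply, Equiv.symm_apply_apply, coeffOne_diag,
    if_pos rfl, one_smul]

lemma unitalDiag_smul_of_ne {x : SlarcDiagram} (hx : x ≠ one n) (s : SlarcSimple k n) :
    unitalDiag k x • s = 0 := by
  classical
  rw [smul_def, ← Unitization.lift_symm_apply_apply, Equiv.symm_apply_apply, coeffOne_diag,
    if_neg hx, zero_smul]

variable (k n)

/-- The basis vector `1_n` of `L_n`. -/
def generator : SlarcSimple k n := (1 : k)

lemma smul_generator (s : SlarcSimple k n) : (show k from s) • generator k n = s :=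
  mul_one (show k from s)

end

end SlarcSimple

namespace SlarcResolution

open DiagramSet SlarcSimple

noncomputable section

variable (k : Type u) [Field k] (n : ℕ)

/-- The term of homological degree `i` of the resolution of `L_n`. -/
abbrev Term (i : ℕ) : Type u := DiagramModule k (MarkedDiagram n i)

/-- The basis of a term of the resolution. -/
abbrev basis (i : ℕ) : Module.Basis (MarkedDiagram n i) k (Term k n i) :=
  DiagramModule.basis k (MarkedDiagram n i)

open Classical in
/-- The projection of the space spanned by all words to a term of the resolution, for words over
`m` left points. -/
def proj (i m : ℕ) : Span k →ₗ[k] Term k n i :=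
  Finsupp.linearCombination k fun w =>
    if h : w ∈ ofDegree n i m then basis k n i ⟨m, w, h⟩ else 0

variable {n}

lemma proj_single {i m : ℕ} {w : SlarcWord} (h : w ∈ ofDegree n i m) :
    proj k n i m (Finsupp.single w 1) = basis k n i ⟨m, w, h⟩ := by
  rw [proj, Finsupp.linearCombination_single, one_smul, dif_pos h]

lemma proj_single_word {i : ℕ} (p : MarkedDiagram n i) :
    proj k n i p.left (Finsupp.single p.word 1) = basis k n i p :=
  proj_single k p.mem

lemma unitalDiag_smul_proj {i : ℕ} (x : SlarcDiagram) {q : Span k}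
    (hq : q ∈ Finsupp.supported k k (ofDegree n i x.right)) :
    unitalDiag k x • proj k n i x.right q = proj k n i x.left (act k x x.rightSarcs q) := by
  refine apply_eq_of_mem_supported
    (f := Algebra.lsmul k k (Term k n i) (unitalDiag k x) ∘ₗ proj k n i x.right)
    (g := proj k n i x.left ∘ₗ act k x x.rightSarcs) (fun w hw => ?_) hq
  change unitalDiag k x • proj k n i x.right (Finsupp.single w 1) = proj k n i x.left _
  rw [proj_single k hw, act_single, actWord]
  have hcomp : Composable x (diagram (⟨x.right, w, hw⟩ : MarkedDiagram n i)) ↔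
      (x.rightSarcs : Set ℕ) ⊆ larcEnds w :=
    (composable_toDiagram hw.1).trans (and_iff_right rfl)
  split_ifs with h
  · rw [DiagramModule.unitalDiag_smul_basis_of_composable (hcomp.2 h),
      proj_single k (map_subst_mem_ofDegree hw x)]
    rfl
  · rw [DiagramModule.unitalDiag_smul_basis_of_not_composable (mt hcomp.1 h), map_zero]

lemma unitalDiag_smul_proj_of_ne {i m : ℕ} {x : SlarcDiagram} (hx : x.right ≠ m) (q : Span k) :
    unitalDiag k x • proj k n i m q = 0 := by
  refine apply_eq_of_apply_single_eq
    (f := Algebra.lsmul k k (Term k n i) (unitalDiag k x) ∘ₗ proj k n i m) (g := 0)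
    (fun w => ?_) q
  change unitalDiag k x • proj k n i m (Finsupp.single w 1) = 0
  rw [proj, Finsupp.linearCombination_single, one_smul]
  split_ifs
  · exact DiagramModule.unitalDiag_smul_basis_of_not_composable fun h => hx h.1
  · exact smul_zero _

variable (n) in
/-- The linear map between two terms of the resolution that is given on basis vectors by a
function on words depending on the number of left points. -/
def wordwise (i j : ℕ) (F : ℕ → SlarcWord → Span k) : Term k n i →ₗ[k] Term k n j :=
  (basis k n i).constr k fun p => proj k n j p.left (F p.left p.word)

lemma wordwise_basis {i j : ℕ} (F : ℕ → SlarcWord → Span k) (p : MarkedDiagram n i) :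
    wordwise k n i j F (basis k n i p) = proj k n j p.left (F p.left p.word) := by
  rw [wordwise, Module.Basis.constr_basis]

lemma wordwise_proj {i j m : ℕ} (F : ℕ → SlarcWord → Span k) {q : Span k}
    (hq : q ∈ Finsupp.supported k k (ofDegree n i m)) :
    wordwise k n i j F (proj k n i m q) =
      proj k n j m (Finsupp.linearCombination k (F m) q) := by
  refine apply_eq_of_mem_supported (f := wordwise k n i j F ∘ₗ proj k n i m)
    (g := proj k n j m ∘ₗ Finsupp.linearCombination k (F m)) (fun w hw => ?_) hq
  rw [LinearMap.comp_apply, proj_single k hw, wordwise_basis, LinearMap.comp_apply,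
    Finsupp.linearCombination_single, one_smul]

variable (n)

/-- The differential of the resolution as a `k`-linear map. -/
def differentialLin (i : ℕ) : Term k n (i + 1) →ₗ[k] Term k n i :=
  wordwise k n (i + 1) i fun _ => diffWord k

/-- The contracting homotopy of the resolution. -/
def contraction (i : ℕ) : Term k n i →ₗ[k] Term k n (i + 1) :=
  wordwise k n i (i + 1) (homotopyWord k)

variable {n}

lemma differentialLin_basis {i : ℕ} (p : MarkedDiagram n (i + 1)) :
    differentialLin k n i (basis k n (i + 1) p) = proj k n i p.left (diffWord k p.word) :=
  wordwise_basis k _ p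

lemma differentialLin_proj {i m : ℕ} {q : Span k}
    (hq : q ∈ Finsupp.supported k k (ofDegree n (i + 1) m)) :
    differentialLin k n i (proj k n (i + 1) m q) = proj k n i m (diff k q) :=
  wordwise_proj k _ hq

lemma contraction_basis {i : ℕ} (p : MarkedDiagram n i) :
    contraction k n i (basis k n i p) = proj k n (i + 1) p.left (homotopyWord k p.left p.word) :=
  wordwise_basis k _ p

lemma contraction_proj {i m : ℕ} {q : Span k}
    (hq : q ∈ Finsupp.supported k k (ofDegree n i m)) :
    contraction k n i (proj k n i m q) = proj k n (i + 1) m (homotopy k m q) :=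
  wordwise_proj k _ hq

lemma differentialLin_unitalDiag_smul {i : ℕ} (x : SlarcDiagram) (q : Term k n (i + 1)) :
    differentialLin k n i (unitalDiag k x • q) = unitalDiag k x • differentialLin k n i q := by
  refine DiagramModule.map_unitalDiag_smul_of_basis _ x (fun ⟨m, w, hw⟩ => ?_) q
  rw [differentialLin_basis, ← proj_single_word]
  by_cases hx : x.right = m
  · subst hx
    have hsarcs (l : ℕ) (_ : 0 ≤ l) (hl : l < x.right) :
        l ∈ (x.rightSarcs : Set ℕ) ↔ ¬ ∃ i, (i, l) ∈ x.larcs := by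
      rw [Finset.mem_coe, rightSarcs_eq_sdiff, Finset.mem_sdiff, mem_rightEnds,
        and_iff_right (Finset.mem_range.2 hl)]
    rw [unitalDiag_smul_proj k x (Finsupp.single_mem_supported k 1 hw), act_single,
      differentialLin_proj k (actWord_mem_supported_ofDegree k hw),
      unitalDiag_smul_proj k x (diffWord_mem_supported_ofDegree k hw),
      act_diffWord k hw.1 hsarcs]
  · rw [unitalDiag_smul_proj_of_ne k hx, unitalDiag_smul_proj_of_ne k hx, map_zero]

variable (n) in
/-- The differential of the resolution. -/
def differential (i : ℕ) : Term k n (i + 1) →ₗ[UnitalSlarcAlgebra k] Term k n i :=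
  linearMapOfCommDiag (differentialLin k n i) (differentialLin_unitalDiag_smul k)

lemma differential_differential {i : ℕ} (q : Term k n (i + 2)) :
    differential k n i (differential k n (i + 1) q) = 0 := by
  have hzero : differentialLin k n i ∘ₗ differentialLin k n (i + 1) = 0 := by
    refine (basis k n (i + 2)).ext fun p => ?_
    rw [LinearMap.comp_apply, differentialLin_basis,
      differentialLin_proj k (diffWord_mem_supported_ofDegree k p.mem), diff_diffWord, map_zero,
      LinearMap.zero_apply]
  exact LinearMap.congr_fun hzero q

lemma differential_contraction_add {i : ℕ} (q : Term k n (i + 1)) :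
    differential k n (i + 1) (contraction k n (i + 1) q) +
      contraction k n i (differential k n i q) = q := by
  have hid : differentialLin k n (i + 1) ∘ₗ contraction k n (i + 1) +
      contraction k n i ∘ₗ differentialLin k n i = LinearMap.id := by
    refine (basis k n (i + 1)).ext fun p => ?_
    have hne : p.word ≠ fullWord 0 p.left := fun h => by
      have hdegree := p.mem.2.1
      rw [h, degree_fullWord] at hdegree
      exact Nat.succ_ne_zero i hdegree.symm
    rw [LinearMap.add_apply, LinearMap.comp_apply, LinearMap.comp_apply, contraction_basis,
      differentialLin_basis, differentialLin_proj k (homotopyWord_mem_supported_ofDegree k p.mem),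
      contraction_proj k (diffWord_mem_supported_ofDegree k p.mem), ← map_add,
      diff_homotopyWord_add k p.valid hne, LinearMap.id_apply, proj_single_word]
  exact LinearMap.congr_fun hid q

variable (n) in
/-- The generator of the term of homological degree `0` that is mapped to the generator of `L_n`. -/
def origin : MarkedDiagram n 0 :=
  ⟨n, fullWord 0 n, by simpa only [zero_add] using valid_fullWord 0 n, degree_fullWord 0 n,
    numDist_fullWord 0 n⟩

lemma word_gen {p : MarkedDiagram n 0} : (gen p).word = fullWord 0 (gen p).left :=
  genFrom_of_degree_eq_zero p.mem.2.1 0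

lemma eq_origin_of_word_eq {p : MarkedDiagram n 0} (h : p.word = fullWord 0 p.left) :
    p = origin n := by
  have hleft : p.left = n := by
    rw [← numDist_fullWord 0 p.left, ← h]
    exact p.mem.2.2
  refine MarkedDiagram.ext hleft ?_
  rw [h, hleft]
  rfl

lemma diagram_origin : diagram (origin n) = one n := by
  rw [← eq_origin_of_word_eq (word_gen (p := origin n)), diagram_gen]
  exact congrArg one (numRight_fullWord 0 n)

lemma diagram_eq_one_iff {p : MarkedDiagram n 0} : diagram p = one n ↔ p = origin n := by
  refine ⟨fun h => ?_, fun h => h ▸ diagram_origin⟩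
  have hleft : (diagram (gen p)).left = n := by
    rw [diagram_gen, h]
    rfl
  have hgen : gen p = p := by
    calc gen p = DiagramSet.act (one (diagram (gen p)).left) (gen p) := (one_act _).symm
      _ = DiagramSet.act (diagram p) (gen p) := by rw [hleft, h]
      _ = p := act_gen p
  exact eq_origin_of_word_eq (hgen ▸ word_gen)

open Classical in
variable (n) in
/-- The augmentation of the resolution as a `k`-linear map. -/
def augmentationLin : Term k n 0 →ₗ[k] SlarcSimple k n :=
  (basis k n 0).constr k fun p => if diagram p = one n then generator k n else 0

lemma augmentationLin_of_eq {p : MarkedDiagram n 0} (h : diagram p = one n) :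
    augmentationLin k n (basis k n 0 p) = generator k n := by
  rw [augmentationLin, Module.Basis.constr_basis, if_pos h]

lemma augmentationLin_of_ne {p : MarkedDiagram n 0} (h : diagram p ≠ one n) :
    augmentationLin k n (basis k n 0 p) = 0 := by
  rw [augmentationLin, Module.Basis.constr_basis, if_neg h]

lemma augmentationLin_unitalDiag_smul (x : SlarcDiagram) (q : Term k n 0) :
    augmentationLin k n (unitalDiag k x • q) = unitalDiag k x • augmentationLin k n q := by
  refine DiagramModule.map_unitalDiag_smul_of_basis _ x (fun p => ?_) q
  by_cases hone : x = one n ∧ diagram p = one n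
  · obtain ⟨hcomp, hconcat⟩ := (eq_one_iff n x (diagram p)).2 hone
    rw [DiagramModule.unitalDiag_smul_basis_of_composable hcomp, augmentationLin_of_eq k hone.2,
      augmentationLin_of_eq k ((diagram_act hcomp).trans hconcat), hone.1, unitalDiag_one_smul]
  · have hright : unitalDiag k x • augmentationLin k n (basis k n 0 p) = 0 := by
      by_cases hp : diagram p = one n
      · exact unitalDiag_smul_of_ne (fun hx => hone ⟨hx, hp⟩) _
      · rw [augmentationLin_of_ne k hp, smul_zero]
    rw [hright]
    by_cases hcomp : Composable x (diagram p)
    · rw [DiagramModule.unitalDiag_smul_basis_of_composable hcomp, augmentationLin_of_ne]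
      rw [diagram_act hcomp]
      exact fun hconcat => hone ((eq_one_iff n x _).1 ⟨hcomp, hconcat⟩)
    · rw [DiagramModule.unitalDiag_smul_basis_of_not_composable hcomp, map_zero]

variable (n) in
/-- The augmentation of the resolution. -/
def augmentation : Term k n 0 →ₗ[UnitalSlarcAlgebra k] SlarcSimple k n :=
  linearMapOfCommDiag (augmentationLin k n) (augmentationLin_unitalDiag_smul k)

variable (n) in
/-- The `k`-linear section of the augmentation. -/
def augmentationSection : SlarcSimple k n →ₗ[k] Term k n 0 :=
  LinearMap.toSpanSingleton k (Term k n 0) (basis k n 0 (origin n))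

lemma augmentationSection_generator :
    augmentationSection k n (generator k n) = basis k n 0 (origin n) :=
  one_smul k _

lemma augmentation_augmentationSection (s : SlarcSimple k n) :
    augmentation k n (augmentationSection k n s) = s := by
  rw [augmentation, linearMapOfCommDiag_apply, augmentationSection]
  change augmentationLin k n ((show k from s) • basis k n 0 (origin n)) = s
  rw [map_smul, augmentationLin_of_eq k diagram_origin, smul_generator]

lemma differential_mem_grading {i j : ℕ} {q : Term k n (i + 1)}
    (hq : q ∈ DiagramModule.grading k (MarkedDiagram n (i + 1)) (i + 1) j) :
    differential k n i q ∈ DiagramModule.grading k (MarkedDiagram n i) i j := by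
  have hle : DiagramModule.grading k (MarkedDiagram n (i + 1)) (i + 1) j ≤
      (DiagramModule.grading k (MarkedDiagram n i) i j).comap (differentialLin k n i) := by
    rw [DiagramModule.grading, Submodule.span_le]
    rintro _ ⟨p, rfl, rfl⟩
    rw [SetLike.mem_coe, Submodule.mem_comap, differentialLin_basis]
    refine apply_mem_of_mem_supported (fun w' hstep => ?_) (diffWord_mem_supported k p.word)
    have hw' := Step.mem_ofDegree hstep p.mem
    rw [proj_single k hw']
    refine Submodule.subset_span ⟨⟨p.left, w', hw'⟩, ?_, rfl⟩
    have hsarcs := Step.numSarcs_toDiagram hstep p.valid hw'.1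
    exact (congrArg (i + ·) hsarcs).trans (by rw [add_assoc, add_comm 1]; rfl)
  exact hle hq

lemma augmentation_eq_zero {j : ℕ} (hj : j ≠ 0) {q : Term k n 0}
    (hq : q ∈ DiagramModule.grading k (MarkedDiagram n 0) 0 j) : augmentation k n q = 0 := by
  have hle : DiagramModule.grading k (MarkedDiagram n 0) 0 j ≤
      LinearMap.ker (augmentationLin k n) := by
    rw [DiagramModule.grading, Submodule.span_le]
    rintro _ ⟨p, rfl, rfl⟩
    refine augmentationLin_of_ne k fun h => hj ?_
    rw [h, numSarcs_one]
  exact hle hq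

lemma augmentation_differential (q : Term k n 1) :
    augmentation k n (differential k n 0 q) = 0 := by
  have hzero : augmentationLin k n ∘ₗ differentialLin k n 0 = 0 := by
    refine (basis k n 1).ext fun p => ?_
    refine augmentation_eq_zero k (Nat.succ_ne_zero (diagram p).numSarcs)
      (differential_mem_grading k (Submodule.subset_span ⟨p, ?_, rfl⟩))
    exact (congrArg (· + _) (zero_add 1)).trans (add_comm _ _)
  exact LinearMap.congr_fun hzero q

lemma sub_augmentationSection_mem_range (q : Term k n 0) :
    q - augmentationSection k n (augmentation k n q) ∈
      LinearMap.range (differentialLin k n 0) := by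
  have hle : (⊤ : Submodule k (Term k n 0)) ≤ (LinearMap.range (differentialLin k n 0)).comap
      (LinearMap.id - augmentationSection k n ∘ₗ augmentationLin k n) := by
    rw [← (basis k n 0).span_eq, Submodule.span_le]
    rintro _ ⟨p, rfl⟩
    rw [SetLike.mem_coe, Submodule.mem_comap, LinearMap.sub_apply, LinearMap.id_apply,
      LinearMap.comp_apply]
    by_cases hp : p = origin n
    · rw [augmentationLin_of_eq k (diagram_eq_one_iff.2 hp), augmentationSection_generator, hp,
        sub_self]
      exact Submodule.zero_mem _
    · rw [augmentationLin_of_ne k (mt diagram_eq_one_iff.1 hp), map_zero, sub_zero]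
      have hhomotopy := diff_homotopyWord_add k p.valid (mt eq_origin_of_word_eq hp)
      rw [diffWord_eq_zero k p.mem.2.1, map_zero, add_zero] at hhomotopy
      refine ⟨contraction k n 0 (basis k n 0 p), ?_⟩
      rw [contraction_basis, differentialLin_proj k (homotopyWord_mem_supported_ofDegree k p.mem),
        hhomotopy, proj_single_word]
  exact hle (Submodule.mem_top (x := q))

lemma exact_differential_augmentation :
    Function.Exact (differential k n 0) (augmentation k n) := by
  refine fun q => ⟨fun hq => ?_, ?_⟩
  · have hmem := sub_augmentationSection_mem_range k q
    rwa [hq, map_zero, sub_zero] at hmem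
  · rintro ⟨q', rfl⟩
    exact augmentation_differential k q'

lemma exact_differential_differential (i : ℕ) :
    Function.Exact (differential k n (i + 1)) (differential k n i) := by
  refine fun q => ⟨fun hq => ⟨contraction k n (i + 1) q, ?_⟩, ?_⟩
  · simpa only [hq, map_zero, add_zero] using differential_contraction_add k q
  · rintro ⟨q', rfl⟩
    exact differential_differential k q'

variable (n) in
/-- The linear resolution of `L_n`. -/
def resolution : LinearResolution (k := k) (idem k) (sarcGrading k) (SlarcSimple k n) where
  P := Term k n
  locallyUnital i := DiagramModule.isLocallyUnital k (MarkedDiagram n i)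
  projective i := DiagramModule.projective k (MarkedDiagram n i)
  grading i := DiagramModule.grading k (MarkedDiagram n i) i
  isInternal i := DiagramModule.isInternal_grading k (MarkedDiagram n i) i
  smul_mem _ _ _ _ ha _ hq := DiagramModule.smul_mem_grading ha hq
  generated i := DiagramModule.span_grading_eq_top k (MarkedDiagram n i) i
  d := differential k n
  d_mem _ _ _ hq := differential_mem_grading k hq
  augmentation := augmentation k n
  augmentation_eq_zero _ hj _ hq := augmentation_eq_zero k hj hq
  augmentation_surjective s := ⟨_, augmentation_augmentationSection k s⟩
  exact_zero := exact_differential_augmentation k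
  exact_succ := exact_differential_differential k

end

end SlarcResolution

/-! ### Simple modules -/

lemma IsLocallyUnital.exists_smul_ne_zero {k A : Type u} [Field k] [NonUnitalRing A] [Module k A]
    [IsScalarTower k A A] [SMulCommClass k A A] {ι : Type v} [DecidableEq ι] {e : ι → A}
    {S : Type w} [AddCommGroup S] [Module k S] [Module (Unitization k A) S]
    [IsScalarTower k (Unitization k A) S] [Nontrivial S] (hS : IsLocallyUnital (k := k) e S) :
    ∃ i, ∃ s : S, (e i : Unitization k A) • s ≠ 0 := by
  by_contra! hzero
  refine bot_ne_top (α := Submodule k S) ?_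
  rw [← hS.submodule_iSup_eq_top, eq_comm, iSup_eq_bot]
  exact fun i => LinearMap.range_eq_bot.2 (LinearMap.ext (hzero i))

/-- The linear resolution of a module obtained from one of an isomorphic module. -/
def LinearResolution.ofEquiv {k A : Type u} [Field k] [NonUnitalRing A] [Module k A]
    [IsScalarTower k A A] [SMulCommClass k A A] {ι : Type*} [DecidableEq ι] {e : ι → A}
    {𝒜 : ℕ → Submodule k A} {S : Type v} [AddCommGroup S] [Module (Unitization k A) S]
    {T : Type w} [AddCommGroup T] [Module (Unitization k A) T]
    (r : LinearResolution (k := k) e 𝒜 S) (f : S ≃ₗ[Unitization k A] T) :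
    LinearResolution (k := k) e 𝒜 T :=
  letI := r.addCommGroup
  letI := r.moduleBase
  letI := r.module
  letI := r.isScalarTower
  { r with
    augmentation := f.toLinearMap ∘ₗ r.augmentation
    augmentation_eq_zero := fun j hj x hx => by
      rw [LinearMap.comp_apply, r.augmentation_eq_zero j hj x hx, map_zero]
    augmentation_surjective := f.surjective.comp r.augmentation_surjective
    exact_zero := fun x => by
      rw [LinearMap.comp_apply, LinearEquiv.coe_coe, f.map_eq_zero_iff]
      exact r.exact_zero x }

namespace SlarcAlgebra

variable {k : Type u} [Field k] {S : Type w} [AddCommGroup S] [Module (UnitalSlarcAlgebra k) S]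
  {n : ℕ}

lemma unitalDiag_one_left_smul (x : SlarcDiagram) (s : S) :
    unitalDiag k (one x.left) • unitalDiag k x • s = unitalDiag k x • s := by
  rw [unitalDiag_smul_smul_of_composable (one_composable_iff.2 rfl), one_concat]

section

variable (hmin : ∀ m < n, ∀ s : S, unitalDiag k (one m) • s = 0)

include hmin

lemma unitalDiag_smul_eq_zero_of_card_larcs_lt {x : SlarcDiagram} (hx : x.larcs.card < n)
    (s : S) : unitalDiag k x • s = 0 := by
  have hright : unitalDiag k x.rightFactor • s = 0 := by
    rw [← unitalDiag_one_left_smul]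
    exact hmin _ hx _
  rw [← concat_leftFactor_rightFactor x,
    ← unitalDiag_smul_smul_of_composable (composable_leftFactor_rightFactor x), hright, smul_zero]

variable {v : S} (hv : unitalDiag k (one n) • v = v)

include hv

lemma unitalDiag_one_smul_unitalDiag_smul {x : SlarcDiagram} (hx : x ≠ one n) :
    unitalDiag k (one n) • unitalDiag k x • v = 0 := by
  by_cases hleft : n = x.left
  · by_cases hright : x.right = n
    · rw [unitalDiag_smul_eq_zero_of_card_larcs_lt hmin (x := x), smul_zero]
      by_contra! hcard
      have hcard_left := x.card_leftSarcs_add_card_larcs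
      have hcard_right := x.card_rightSarcs_add_card_larcs
      rw [← hleft] at hcard_left
      rw [hright] at hcard_right
      have hcard_eq : x.larcs.card = n := by omega
      exact hx ((eq_one_of_card_larcs (by omega) (by omega)).trans (congrArg one hcard_eq))
    · rw [← hv, unitalDiag_smul_smul_of_not_composable (mt composable_one_iff.1 hright), smul_zero]
  · exact unitalDiag_smul_smul_of_not_composable (mt one_composable_iff.1 hleft) v

variable [Module k S] [IsScalarTower k (UnitalSlarcAlgebra k) S]

lemma unitalDiag_one_smul_smul_unitalDiag_smul {x : SlarcDiagram} (hx : x ≠ one n)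
    (a : UnitalSlarcAlgebra k) : unitalDiag k (one n) • a • unitalDiag k x • v = 0 := by
  induction a using unital_induction with
  | one => rw [one_smul, unitalDiag_one_smul_unitalDiag_smul hmin hv hx]
  | unitalDiag y =>
    by_cases hyx : Composable y x
    · rw [unitalDiag_smul_smul_of_composable hyx]
      exact unitalDiag_one_smul_unitalDiag_smul hmin hv
        fun h => hx ((eq_one_iff n y x).1 ⟨hyx, h⟩).2
    · rw [unitalDiag_smul_smul_of_not_composable hyx, smul_zero]
  | add a b ha hb => rw [add_smul, smul_add, ha, hb, add_zero]
  | smul c a ha => rw [smul_assoc, smul_algebra_smul_comm, ha, smul_zero]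

lemma unitalDiag_smul_eq_zero_of_isSimpleModule [IsSimpleModule (UnitalSlarcAlgebra k) S]
    {x : SlarcDiagram} (hx : x ≠ one n) : unitalDiag k x • v = 0 := by
  by_contra hxv
  obtain ⟨a, ha⟩ := IsSimpleModule.toSpanSingleton_surjective (UnitalSlarcAlgebra k) hxv v
  rw [LinearMap.toSpanSingleton_apply] at ha
  refine hxv ?_
  rw [← hv, ← ha, unitalDiag_one_smul_smul_unitalDiag_smul hmin hv hx, smul_zero]

end

variable [Module k S] [IsScalarTower k (UnitalSlarcAlgebra k) S]

lemma exists_ne_zero_forall_unitalDiag_smul_eq_zero [IsSimpleModule (UnitalSlarcAlgebra k) S]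
    (hS : IsLocallyUnital (k := k) (idem k) S) :
    ∃ (n : ℕ) (v : S), v ≠ 0 ∧ unitalDiag k (one n) • v = v ∧
      ∀ x ≠ one n, unitalDiag k x • v = 0 := by
  classical
  have := IsSimpleModule.nontrivial (UnitalSlarcAlgebra k) S
  have hexists := hS.exists_smul_ne_zero
  obtain ⟨s, hs⟩ := Nat.find_spec hexists
  have hmin (m : ℕ) (hm : m < Nat.find hexists) (t : S) : unitalDiag k (one m) • t = 0 :=
    not_not.1 (not_exists.1 (Nat.find_min hexists hm) t)
  have hfix := unitalDiag_one_left_smul (k := k) (one (Nat.find hexists)) s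
  exact ⟨_, _, hs, hfix, fun _ => unitalDiag_smul_eq_zero_of_isSimpleModule hmin hfix⟩

lemma exists_nonempty_linearEquiv_slarcSimple [IsSimpleModule (UnitalSlarcAlgebra k) S]
    (hS : IsLocallyUnital (k := k) (idem k) S) :
    ∃ n, Nonempty (SlarcSimple k n ≃ₗ[UnitalSlarcAlgebra k] S) := by
  obtain ⟨n, v, hv_ne, hv, hzero⟩ := exists_ne_zero_forall_unitalDiag_smul_eq_zero hS
  let g : SlarcSimple k n →ₗ[k] S := LinearMap.toSpanSingleton k S v
  have hg (c : SlarcSimple k n) : g c = (show k from c) • v := rfl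
  let f : SlarcSimple k n →ₗ[UnitalSlarcAlgebra k] S := linearMapOfCommDiag g fun x c => by
    by_cases hx : x = one n
    · rw [hx, SlarcSimple.unitalDiag_one_smul, hg, smul_algebra_smul_comm, hv]
    · rw [SlarcSimple.unitalDiag_smul_of_ne hx, map_zero, hg, smul_algebra_smul_comm, hzero x hx,
        smul_zero]
  have hinjective : Function.Injective f := by
    refine (injective_iff_map_eq_zero f).2 fun c hc => ?_
    exact (smul_eq_zero.1 ((hg c).symm.trans hc)).resolve_right hv_ne
  have hsurjective : Function.Surjective f := by
    refine LinearMap.surjective_of_ne_zero fun hf => hv_ne ?_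
    have hfv : f (SlarcSimple.generator k n) = v := one_smul k v
    rw [← hfv, hf, LinearMap.zero_apply]
  exact ⟨n, ⟨LinearEquiv.ofBijective f ⟨hinjective, hsurjective⟩⟩⟩

lemma nonempty_linearResolution [IsSimpleModule (UnitalSlarcAlgebra k) S]
    (hS : IsLocallyUnital (k := k) (idem k) S) :
    Nonempty (LinearResolution (k := k) (idem k) (sarcGrading k) S) := by
  obtain ⟨n, ⟨f⟩⟩ := exists_nonempty_linearEquiv_slarcSimple hS
  exact ⟨(SlarcResolution.resolution k n).ofEquiv f⟩

variable (k) in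
lemma isKoszulAlgebra : IsKoszulAlgebra.{u, 0, w} (idem k) (sarcGrading k) where
  ne_zero n := (basis k).ne_zero (one n)
  idempotent n := (idem_mul_diag n (one n)).trans (if_pos rfl)
  orthogonal m n hmn := (idem_mul_diag m (one n)).trans (if_neg hmn.symm)
  peirce := isInternal_peirce k
  isInternal := isInternal_sarcGrading k
  mul_mem _ _ _ ha _ hb := mul_mem_sarcGrading ha hb
  degree_zero := sarcGrading_zero k
  linear _ _ _ _ _ _ hS _ := nonempty_linearResolution hS

end SlarcAlgebra

theorem mainTheorem10 (k : Type u) [Field k] :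
    IsKoszulAlgebra.{u, 0, w} (SlarcAlgebra.idem k) (SlarcAlgebra.sarcGrading k) ∧
    (∀ n : ℕ, Nonempty (LinearResolution (k := k) (SlarcAlgebra.idem k)
      (SlarcAlgebra.sarcGrading k) (SlarcSimple k n))) ∧
    (∀ (S : Type w) [AddCommGroup S] [Module k S] [Module (Unitization k (SlarcAlgebra k)) S]
      [IsScalarTower k (Unitization k (SlarcAlgebra k)) S],
      IsSimpleModule (Unitization k (SlarcAlgebra k)) S →
      IsLocallyUnital (k := k) (SlarcAlgebra.idem k) S →
      Nonempty (LinearResolution (k := k) (SlarcAlgebra.idem k)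
        (SlarcAlgebra.sarcGrading k) S)) := by
  refine ⟨SlarcAlgebra.isKoszulAlgebra k, fun n => ⟨SlarcResolution.resolution k n⟩, ?_⟩
  intro S _ _ _ _ _ hS
  exact SlarcAlgebra.nonempty_linearResolution hS
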